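/- All Banach spaces are real and nonzero. For $i=1,2$ let $K_i$ be a compact Hausdorff space, $E_i$ a Banach space, and $\mathcal H_i$ a closed linear subspace of $\mathcal C(K_i,E_i)$, the space of continuous $E_i$-valued functions on $K_i$ with the supremum norm. For a closed subspace $\mathcal H\subseteq\mathcal C(K,E)$, let $\mathcal A\subseteq \mathcal C(K,\mathbb R)$ be the closed linear span of the functions $x\mapsto\langle e^*,h(x)\rangle$ with $e^*\in E^*$, $h\in\mathcal H$, and let $\mathcal A^E$ be the set of all $f\in\mathcal A$ such that for each $e\in E$ the function $x\mapsto f(x)e$ belongs to $\mathcal H$. Let $\operatorname{Ch}_{\mathcal H}K$ be the set of all $x\in K$ for which the functional $f\mapsto f(x)$ on $\mathcal A$ is an extreme point of the closed unit ball of $\mathcal A^*$. A point $x\in K$ is a weak peak point with respect to $\mathcal H$ if for each neighbourhood $U$ of $x$ and each $\varepsilon\in(0,1)$ there is $h\in\mathcal A^E$ with $0\le h\le 1$ on $K$, $h(x)>1-\varepsilon$, and $h<\varepsilon$ on $\operatorname{Ch}_{\mathcal H}K\setminus U$; the set of all weak peak points is denoted by $\mathcal W_{\mathcal H}$. Let $\Omega_{\mathcal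 H}=\{y\in K:\ g(y)\ne0\text{ for some }g\in\mathcal H\}$. A set $\mathcal B\subseteq K$ is a boundary for $\mathcal H$ if $\|h\|=\sup_{x\in\mathcal B}\|h(x)\|$ for every $h\in\mathcal H$ (with $\sup\emptyset=0$). For a subset $S$ of a topological space, with the subspace topology, $S^{(0)}=S$, $S^{(\alpha+1)}$ is the set of accumulation points of $S^{(\alpha)}$ that belong to $S^{(\alpha)}$, and $S^{(\alpha)}=\bigcap_{\beta<\alpha}S^{(\beta)}$ for limit $\alpha$. Suppose that $E_2$ contains no isomorphic copy of $c_0$, that $\mathcal B\subseteq K_2$ is a closed boundary for $\mathcal H_2$, and that there is an into isomorphism $T:\mathcal H_1\to\mathcal H_2$ (a linear homeomorphism onto its range, on which $T^{-1}$ is defined) with $\|T\|\,\|T^{-1}\|<3$. Then for every ordinal $\alpha$: (a) if $\mathcal W_{\mathcal H_1}^{(\alpha)}$ is nonempty, then so is $\mathcal B^{(\alpha)}\cap\Omega_{\mathcal H_2}$; (b) if $\mathcal B^{(\alpha)}\cap\Omega_{\mathcal H_2}$ is finite, then so is $\mathcal W_{\mathcal H_1}^{(\alpha)}$; (c) if $\mathcal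 B^{(\alpha)}\cap\Omega_{\mathcal H_2}$ is finite, then $E_2^m$ contains an isomorphic copy of $E_1^n$, where $n=|\mathcal W_{\mathcal H_1}^{(\alpha)}|$ and $m=|\mathcal B^{(\alpha)}\cap\Omega_{\mathcal H_2}|$; in particular, if $E_1$ is finite-dimensional and isomorphic to $E_2$ (for example, $E_1=E_2$), then $n\le m$; (d) if $\mathcal H_1$ contains all constant functions and $\mathcal B^{(\alpha)}\cap\Omega_{\mathcal H_2}$ is infinite, then $|\mathcal W_{\mathcal H_1}^{(\alpha)}|\le|\mathcal B^{(\alpha)}\cap\Omega_{\mathcal H_2}|$. -/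

import Mathlib

open Set Topology Cardinal CantorBendixson

universe u v w

noncomputable section

namespace VectorFunctionSpace

/-- `X` contains an isomorphic copy of `Y`: some linear subspace of `X` is linearly homeomorphic
to `Y`. -/
def ContainsCopy (X Y : Type*) [NormedAddCommGroup X] [NormedSpace ℝ X]
    [NormedAddCommGroup Y] [NormedSpace ℝ Y] : Prop :=
  ∃ M : Submodule ℝ X, Nonempty (Y ≃L[ℝ] M)

/-- `X` contains an isomorphic copy of the Banach space `c₀` of real null sequences. -/
def ContainsC0 (X : Type*) [NormedAddCommGroup X] [NormedSpace ℝ X] : Prop :=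
  ContainsCopy X (ZeroAtInftyContinuousMap ℕ ℝ)

variable {K E : Type*} [TopologicalSpace K] [NormedAddCommGroup E] [NormedSpace ℝ E]

/-- The function `e*(h) : x ↦ ⟨e*, h x⟩`. -/
def dualComp (e' : StrongDual ℝ E) (h : C(K, E)) : C(K, ℝ) :=
  ⟨fun x => e' (h x), e'.continuous.comp h.continuous⟩

/-- The function `f ⊗ e : x ↦ f x • e`. -/
def tensor (f : C(K, ℝ)) (e : E) : C(K, E) :=
  ⟨fun x => f x • e, f.continuous.smul continuous_const⟩

/-- The set `Ω_H` of the points at which some function from `H` does not vanish. -/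
def nonvanishingSet (H : Submodule ℝ C(K, E)) : Set K :=
  {y | ∃ g ∈ H, g y ≠ 0}

variable [CompactSpace K]

/-- The canonical scalar function space `A ⊆ C(K)` of `H`: the closed linear span of the functions
`e*(h)`, where `e* ∈ E*` and `h ∈ H`. -/
def scalarSpace (H : Submodule ℝ C(K, E)) : Submodule ℝ C(K, ℝ) :=
  (Submodule.span ℝ {f | ∃ e' : StrongDual ℝ E, ∃ h ∈ H, f = dualComp e' h}).topologicalClosure

/-- The space `A^E` of those `f ∈ A` for which `f ⊗ e ∈ H` for each `e ∈ E`. -/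
def tensorSpace (H : Submodule ℝ C(K, E)) : Submodule ℝ C(K, ℝ) where
  carrier := {f | f ∈ scalarSpace H ∧ ∀ e : E, tensor f e ∈ H}
  add_mem' := by
    rintro f g ⟨hf, hf'⟩ ⟨hg, hg'⟩
    refine ⟨add_mem hf hg, fun e => ?_⟩
    have h : tensor (f + g) e = tensor f e + tensor g e := by
      ext x
      simp [tensor, add_smul]
    rw [h]
    exact add_mem (hf' e) (hg' e)
  zero_mem' := by
    refine ⟨zero_mem _, fun e => ?_⟩
    have h : tensor (0 : C(K, ℝ)) e = 0 := by
      ext x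
      simp [tensor]
    rw [h]
    exact zero_mem _
  smul_mem' := by
    rintro c f ⟨hf, hf'⟩
    refine ⟨Submodule.smul_mem _ c hf, fun e => ?_⟩
    have h : tensor (c • f) e = c • tensor f e := by
      ext x
      simp [tensor, mul_smul]
    rw [h]
    exact Submodule.smul_mem _ c (hf' e)

/-- The evaluation functional `i(x) : f ↦ f x` on a subspace `A` of `C(K)`. -/
def evalOn (A : Submodule ℝ C(K, ℝ)) (x : K) : StrongDual ℝ A :=
  (ContinuousMap.evalCLM ℝ x).comp A.subtypeL

/-- The closed unit ball of the dual space of a subspace `A` of `C(K)`: the continuous linear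
functionals on `A` of norm at most `1`. -/
def dualUnitBall (A : Submodule ℝ C(K, ℝ)) : Set (StrongDual ℝ A) :=
  {φ | ∀ f : A, |φ f| ≤ ‖f‖}

/-- The Choquet boundary of `H`: the set of those `x ∈ K` for which the evaluation at `x` is an
extreme point of the closed unit ball of the dual of the canonical scalar function space. -/
def choquetBoundary (H : Submodule ℝ C(K, E)) : Set K :=
  {x | evalOn (scalarSpace H) x ∈ extremePoints ℝ (dualUnitBall (scalarSpace H))}

/-- The set `W_H` of weak peak points of `K` with respect to `H`. -/
def weakPeakPoints (H : Submodule ℝ C(K, E)) : Set K :=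
  {x | ∀ U ∈ 𝓝 x, ∀ ε : ℝ, 0 < ε → ε < 1 →
    ∃ h ∈ tensorSpace H, (∀ y, 0 ≤ h y ∧ h y ≤ 1) ∧ 1 - ε < h x ∧
      ∀ y ∈ choquetBoundary H \ U, h y < ε}

/-- `B ⊆ K` is a boundary for `H`: `‖h‖ = sup_{x ∈ B} ‖h x‖` for each `h ∈ H`
(the supremum over the empty set is `0`; it is finite since `‖h x‖ ≤ ‖h‖`). -/
def IsBoundary (H : Submodule ℝ C(K, E)) (B : Set K) : Prop :=
  ∀ h ∈ H, ‖h‖ = ⨆ x : B, ‖h x‖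

end VectorFunctionSpace

end

/-! Rescale `T` to an operator `τ` of norm at most `L < 3` with `‖g‖ ≤ sup_B ‖τ g‖`. Let `x` be a
weak peak point and `e` a unit vector, and let `f₀` have norm about one and be close to `e` near
`x`. If `k` peaks sharply at `x`, then `f₀ + 2 k ⊗ e` has norm about 3. Subtracting `2 h ⊗ e` for
another function `h` peaking at `x`, or subtracting `2 f₀`, brings the norm down to about 1. So if
at each `y ∈ B` either `τ f₀` or some `τ (h ⊗ e)` were small, the norm would be at most about `L <
3`. Hence some `y ∈ B` makes all of them large (`exists_mem_forall_le_norm`).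

Transfinite induction places such a `y` in the `α`-th derivative of `B` whenever `x` is in that of
the weak peak points (`nonempty_inter_largeSet`). At a successor, peak functions at distinct points
near `x`, with disjoint essential supports, form a weakly unconditionally Cauchy series. Since `E₂`
has no copy of `c₀`, each `y` is large for only finitely many of them (`finite_setOf_le_apply`), so
infinitely many partners `y` exist and compactness gives an accumulation point.

The same finiteness makes a choice `x ↦ y` finite-to-one (`exists_finite_fibers`), which gives (a),
(b) and (d). For (c), sums `∑ hᵢ ⊗ vᵢ` of peak functions embed `E₁ⁿ` in `H₁`, and evaluating their
images at the finitely many possible partners is still bounded below (`containsCopy_of_finite`).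

Peak functions are controlled only on the Choquet boundary, so sup norms are estimated there
(`norm_le_of_forall_mem_choquetBoundary`). -/

noncomputable section

namespace VectorFunctionSpace

/-! ### Copies of `c₀` and weakly unconditionally Cauchy series. -/

section ContainsC0

variable {X Y : Type*} [NormedAddCommGroup X] [NormedSpace ℝ X]
  [NormedAddCommGroup Y] [NormedSpace ℝ Y]

theorem containsCopy_of_bounds (S : Y →ₗ[ℝ] X) {c C : ℝ} (hc : 0 < c)
    (hlow : ∀ y, c * ‖y‖ ≤ ‖S y‖) (hup : ∀ y, ‖S y‖ ≤ C * ‖y‖) : ContainsCopy X Y := by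
  have hinj : Function.Injective S := by
    rw [injective_iff_map_eq_zero]
    intro y hy
    have h := hlow y
    rw [hy, norm_zero] at h
    exact norm_le_zero_iff.1 (by nlinarith [norm_nonneg y])
  refine ⟨LinearMap.range S, ⟨(LinearEquiv.ofInjective S hinj).toContinuousLinearEquivOfBounds
    C c⁻¹ (fun y => hup y) ?_⟩⟩
  intro z
  obtain ⟨y, rfl⟩ := (LinearEquiv.ofInjective S hinj).surjective z
  rw [LinearEquiv.symm_apply_apply, ← div_eq_inv_mul, le_div_iff₀ hc, mul_comm]
  exact hlow y

/-- A finitary form of Rosenthal's disjointness lemma. -/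
theorem exists_injective_sum_le {η : ℝ} (hη : 0 ≤ η) (N : ℕ) : ∀ b : ℕ → ℕ → ℝ,
    (∀ i (s : Finset ℕ), i ∉ s → ∑ j ∈ s, b i j ≤ N * η) →
    ∃ σ : ℕ → ℕ, Function.Injective σ ∧
      ∀ i (s : Finset ℕ), i ∉ s → ∑ j ∈ s, b (σ i) (σ j) ≤ η := by
  induction N with
  | zero =>
    intro b hs
    exact ⟨id, Function.injective_id, fun i s hi => (hs i s hi).trans (by simpa using hη)⟩
  | succ N ih =>
    intro b hs
    -- `Nat.pair` splits `ℕ` into infinitely many infinite rows. If no row works, each row `p` has a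
    -- point `(p, j p)` and a finite set `s p` whose sum exceeds `η`. Along the transversal of these
    -- points the disjoint block `s p` uses up `η` of the budget, leaving `N * η`.
    by_cases hp : ∃ p, ∀ i (s : Finset ℕ), i ∉ s →
        ∑ j ∈ s, b (Nat.pair p i) (Nat.pair p j) ≤ η
    · obtain ⟨p, hp⟩ := hp
      exact ⟨Nat.pair p, fun i j h => (Nat.pair_eq_pair.1 h).2, hp⟩
    · push Not at hp
      choose j s hj hlt using hp
      set τ : ℕ → ℕ := fun p => Nat.pair p (j p) with hτ
      have hτinj : Function.Injective τ := fun p q h => (Nat.pair_eq_pair.1 h).1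
      obtain ⟨σ, hσ, hσs⟩ := ih (fun p q => b (τ p) (τ q)) (by
        intro p t hp
        have hpair : Function.Injective (Nat.pair p) := fun i j h => (Nat.pair_eq_pair.1 h).2
        have hdisj : Disjoint (t.map ⟨τ, hτinj⟩) ((s p).map ⟨Nat.pair p, hpair⟩) := by
          rw [Finset.disjoint_left]
          intro a ha ha'
          simp only [Finset.mem_map, Function.Embedding.coeFn_mk] at ha ha'
          obtain ⟨q, hq, rfl⟩ := ha
          obtain ⟨k, hk, hkq⟩ := ha'
          obtain ⟨rfl, -⟩ := Nat.pair_eq_pair.1 hkq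
          exact hp hq
        have h := hs (τ p) (t.map ⟨τ, hτinj⟩ ∪ (s p).map ⟨Nat.pair p, hpair⟩) (by
          simp only [Finset.mem_union, Finset.mem_map, Function.Embedding.coeFn_mk, not_or,
            not_exists, not_and]
          refine ⟨fun q hq h => hp (hτinj h ▸ hq), fun k hk h => hj p ?_⟩
          rw [← (Nat.pair_eq_pair.1 h).2]
          exact hk)
        rw [Finset.sum_union hdisj, Finset.sum_map, Finset.sum_map] at h
        have h' := hlt p
        simp only [Function.Embedding.coeFn_mk, Nat.cast_add, Nat.cast_one] at h
        simp only [hτ] at h ⊢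
        linarith)
      exact ⟨τ ∘ σ, hτinj.comp hσ, hσs⟩

/-- The closed linear span of a sequence that satisfies both `c₀`-estimates is a copy of `c₀`. -/
theorem containsC0_of_estimates [CompleteSpace X] {v : ℕ → X} {C η : ℝ} (hη : 0 < η)
    (hup : ∀ (s : Finset ℕ) (a : ℕ → ℝ) (r : ℝ), (∀ n ∈ s, |a n| ≤ r) → 0 ≤ r →
      ‖∑ n ∈ s, a n • v n‖ ≤ C * r)
    (hlow : ∀ (s : Finset ℕ) (a : ℕ → ℝ), ∀ n ∈ s, η * |a n| ≤ ‖∑ n ∈ s, a n • v n‖) :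
    ContainsC0 X := by
  have hC : 0 ≤ C := by simpa using hup ∅ 0 1 (by simp) zero_le_one
  have hf : ∀ (f : ZeroAtInftyContinuousMap ℕ ℝ) n, |f n| ≤ ‖f‖ := by
    intro f n
    rw [← ZeroAtInftyContinuousMap.norm_toBCF_eq_norm]
    exact f.toBCF.norm_coe_le_norm n
  have hsum : ∀ f : ZeroAtInftyContinuousMap ℕ ℝ, Summable fun n => f n • v n := by
    intro f
    rw [summable_iff_vanishing_norm]
    intro ε hε
    have h0 : ∀ᶠ n in Filter.cofinite, f n ∈ Metric.ball (0 : ℝ) (ε / (C + 1)) := by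
      have := f.zero_at_infty'
      rw [Filter.cocompact_eq_cofinite] at this
      exact this (Metric.ball_mem_nhds _ (by positivity))
    rw [Filter.eventually_cofinite] at h0
    refine ⟨h0.toFinset, fun t ht => ?_⟩
    refine (hup t f (ε / (C + 1)) (fun n hn => ?_) (by positivity)).trans_lt ?_
    · have h1 := Finset.disjoint_left.1 ht hn
      simp only [Finite.mem_toFinset, mem_ofPred_eq, not_not, mem_ball_zero_iff,
        Real.norm_eq_abs] at h1
      exact h1.le
    · rw [mul_div_assoc', div_lt_iff₀ (by positivity)]
      nlinarith
  let S : ZeroAtInftyContinuousMap ℕ ℝ →ₗ[ℝ] X :=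
    { toFun := fun f => ∑' n, f n • v n
      map_add' := fun f g => by
        rw [← (hsum f).tsum_add (hsum g)]
        exact tsum_congr fun n => add_smul _ _ _
      map_smul' := fun c f => by
        rw [RingHom.id_apply, ← (hsum f).tsum_const_smul]
        exact tsum_congr fun n => smul_assoc c (f n) (v n) }
  have hS : ∀ f, Filter.Tendsto (fun s : Finset ℕ => ‖∑ n ∈ s, f n • v n‖) Filter.atTop
      (𝓝 ‖S f‖) := fun f => (hsum f).hasSum.norm
  refine containsCopy_of_bounds S hη (C := C) (fun f => ?_) (fun f => ?_)
  · rw [← le_div_iff₀' hη, ← ZeroAtInftyContinuousMap.norm_toBCF_eq_norm,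
      BoundedContinuousFunction.norm_le (by positivity)]
    intro n
    rw [le_div_iff₀' hη]
    refine ge_of_tendsto (hS f) ?_
    filter_upwards [Filter.eventually_ge_atTop {n}] with s hs
    exact hlow s f n (hs (Finset.mem_singleton_self n))
  · exact le_of_tendsto (hS f) (Filter.Eventually.of_forall fun s =>
      hup s f _ (fun n _ => hf f n) (norm_nonneg _))

/-- The Bessaga-Pełczyński theorem: if `X` contains no copy of `c₀`, then the terms of a
weakly unconditionally Cauchy series in `X` tend to zero. -/
theorem finite_setOf_le_norm [CompleteSpace X] (hX : ¬ ContainsC0 X) {v : ℕ → X} {C δ : ℝ}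
    (hδ : 0 < δ)
    (hC : ∀ (s : Finset ℕ) (a : ℕ → ℝ), (∀ n, |a n| ≤ 1) → ‖∑ n ∈ s, a n • v n‖ ≤ C) :
    {n | δ ≤ ‖v n‖}.Finite := by
  by_contra hinf
  have hinf : {n | δ ≤ ‖v n‖}.Infinite := hinf
  have hC0 : 0 ≤ C := by simpa using hC ∅ 0 (by simp)
  have hsub : ∀ σ : ℕ → ℕ, Function.Injective σ → ∀ (s : Finset ℕ) (a : ℕ → ℝ),
      (∀ n, |a n| ≤ 1) → ‖∑ n ∈ s, a n • v (σ n)‖ ≤ C := by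
    intro σ hσ s a ha
    have h := hC (s.map ⟨σ, hσ⟩) (a ∘ Function.invFun σ) (fun n => ha _)
    simpa [Finset.sum_map, Function.leftInverse_invFun hσ _] using h
  set ρ : ℕ → ℕ := fun n => hinf.natEmbedding _ n with hρ
  have hρinj : Function.Injective ρ :=
    Subtype.val_injective.comp (hinf.natEmbedding _).injective
  have hρδ : ∀ n, δ ≤ ‖v (ρ n)‖ := fun n => (hinf.natEmbedding _ n).2
  choose φ hφ hφv using fun n => exists_dual_vector'' ℝ (v (ρ n))
  obtain ⟨N, hN⟩ := exists_nat_ge (C / (δ / 2))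
  -- The functionals `φ n` norm `v (ρ n)`, so the diagonal entries are at least `δ`. Thinning out
  -- makes each off-diagonal row sum at most `δ / 2`, and the difference is the lower `c₀`-estimate.
  obtain ⟨σ, hσ, hσs⟩ := exists_injective_sum_le (η := δ / 2) (by positivity) N
    (fun n k => |φ n (v (ρ k))|) (by
      intro i s _
      rw [div_le_iff₀ (by positivity)] at hN
      refine le_trans ?_ hN
      set a : ℕ → ℝ := fun k => SignType.sign (φ i (v (ρ k))) with ha
      have h1 : ∑ k ∈ s, |φ i (v (ρ k))| = φ i (∑ k ∈ s, a k • v (ρ k)) := by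
        rw [map_sum]
        refine Finset.sum_congr rfl fun k _ => ?_
        rw [map_smul, smul_eq_mul, sign_mul_self]
      rw [h1]
      have h2 := hsub ρ hρinj s a (fun n => by
        simp only [ha]
        rcases lt_trichotomy (φ i (v (ρ n))) 0 with h | h | h <;> simp [h])
      calc φ i (∑ k ∈ s, a k • v (ρ k)) ≤ ‖φ i (∑ k ∈ s, a k • v (ρ k))‖ := le_abs_self _
        _ ≤ ‖φ i‖ * ‖∑ k ∈ s, a k • v (ρ k)‖ := (φ i).le_opNorm _
        _ ≤ 1 * C := mul_le_mul (hφ i) h2 (norm_nonneg _) zero_le_one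
        _ = C := one_mul C)
  refine hX (containsC0_of_estimates (v := fun n => v (ρ (σ n))) (C := C) (η := δ / 2)
    (by positivity) ?_ ?_)
  · intro s a r ha hr
    rcases hr.eq_or_lt with rfl | hr
    · rw [Finset.sum_eq_zero fun n hn => by
        rw [abs_nonpos_iff.1 (ha n hn), zero_smul]]
      simp
    have h := hsub (ρ ∘ σ) (hρinj.comp hσ) s (fun n => if n ∈ s then r⁻¹ * a n else 0) (by
      intro n
      split_ifs with hn
      · rw [abs_mul, abs_of_pos (inv_pos.2 hr), inv_mul_le_iff₀ hr, mul_one]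
        exact ha n hn
      · simp)
    have h2 : ∑ n ∈ s, (if n ∈ s then r⁻¹ * a n else 0) • v ((ρ ∘ σ) n)
        = r⁻¹ • ∑ n ∈ s, a n • v (ρ (σ n)) := by
      rw [Finset.smul_sum]
      refine Finset.sum_congr rfl fun n hn => ?_
      simp [hn, mul_smul]
    rw [h2, norm_smul, Real.norm_of_nonneg (inv_pos.2 hr).le, inv_mul_le_iff₀ hr] at h
    linarith
  · intro s a n hn
    obtain ⟨m, hm, hmax⟩ := s.exists_max_image (fun k => |a k|) ⟨n, hn⟩
    have h1 : φ (σ m) (∑ k ∈ s, a k • v (ρ (σ k)))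
        = a m * ‖v (ρ (σ m))‖ + ∑ k ∈ s.erase m, a k * φ (σ m) (v (ρ (σ k))) := by
      rw [map_sum, ← Finset.add_sum_erase s _ hm]
      simp only [map_smul, smul_eq_mul, hφv, RCLike.ofReal_real_eq_id, id]
    have h2 : |∑ k ∈ s.erase m, a k * φ (σ m) (v (ρ (σ k)))| ≤ |a m| * (δ / 2) := by
      calc |∑ k ∈ s.erase m, a k * φ (σ m) (v (ρ (σ k)))|
          ≤ ∑ k ∈ s.erase m, |a m| * |φ (σ m) (v (ρ (σ k)))| := by
            refine (Finset.abs_sum_le_sum_abs _ _).trans (Finset.sum_le_sum fun k hk => ?_)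
            rw [abs_mul]
            exact mul_le_mul_of_nonneg_right (hmax k (Finset.mem_of_mem_erase hk)) (abs_nonneg _)
        _ ≤ |a m| * (δ / 2) := by
            rw [← Finset.mul_sum]
            exact mul_le_mul_of_nonneg_left (hσs m _ (Finset.notMem_erase m s)) (abs_nonneg _)
    have h3 : |φ (σ m) (∑ k ∈ s, a k • v (ρ (σ k)))| ≤ ‖∑ k ∈ s, a k • v (ρ (σ k))‖ := by
      refine ((φ (σ m)).le_opNorm _).trans ?_
      exact mul_le_of_le_one_left (norm_nonneg _) (hφ _)
    have h4 : |a m| * δ ≤ |a m * ‖v (ρ (σ m))‖| := by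
      rw [abs_mul, abs_of_nonneg (norm_nonneg _)]
      exact mul_le_mul_of_nonneg_left (hρδ _) (abs_nonneg _)
    have h5 := abs_sub_abs_le_abs_sub (a m * ‖v (ρ (σ m))‖)
      (-∑ k ∈ s.erase m, a k * φ (σ m) (v (ρ (σ k))))
    rw [abs_neg, sub_neg_eq_add, ← h1] at h5
    have h6 := hmax n hn
    nlinarith

end ContainsC0

/-! ### Extreme functionals are signed evaluations; the Choquet boundary is norming. -/

section ChoquetBoundary

variable {K E : Type*} [TopologicalSpace K] [CompactSpace K] [NormedAddCommGroup E]
  [NormedSpace ℝ E]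

variable {Y Z : Type*} [NormedAddCommGroup Y] [NormedSpace ℝ Y] [NormedAddCommGroup Z]
  [NormedSpace ℝ Z]

/-- The closed unit ball of the dual of a normed space. -/
def functionalBall (Y : Type*) [NormedAddCommGroup Y] [NormedSpace ℝ Y] : Set (StrongDual ℝ Y) :=
  {φ | ∀ f : Y, |φ f| ≤ ‖f‖}

theorem functionalBall_eq_closedBall :
    functionalBall Y = Metric.closedBall (0 : StrongDual ℝ Y) 1 := by
  ext φ
  rw [mem_closedBall_zero_iff]
  refine ⟨fun hφ => φ.opNorm_le_bound zero_le_one fun f => by simpa using hφ f, fun hφ f => ?_⟩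
  exact (φ.le_opNorm f).trans (mul_le_of_le_one_left (norm_nonneg _) hφ)

theorem neg_mem_functionalBall {φ : StrongDual ℝ Y} (hφ : φ ∈ functionalBall Y) :
    -φ ∈ functionalBall Y := by
  intro f
  simpa using hφ f

/-- For `0 < a < 1`, `φ` is the convex combination of `a⁻¹ • u` and `(1 - a)⁻¹ • w`, both in the
unit ball, so extremality identifies them with `φ`. At `a = 0` or `a = 1` one summand vanishes. -/
theorem eq_smul_of_mem_extremePoints {φ u w : StrongDual ℝ Y}
    (hφ : φ ∈ extremePoints ℝ (functionalBall Y)) (huw : φ = u + w) {a : ℝ} (ha : 0 ≤ a)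
    (ha' : a ≤ 1) (hu : ∀ f, |u f| ≤ a * ‖f‖) (hw : ∀ f, |w f| ≤ (1 - a) * ‖f‖) :
    u = a • φ := by
  rcases ha.eq_or_lt with rfl | ha
  · ext f
    simpa using hu f
  rcases ha'.eq_or_lt with rfl | ha'
  · have : w = 0 := by
      ext f
      simpa using hw f
    rw [huw, this]
    simp
  have hb : 0 < 1 - a := sub_pos.2 ha'
  have h := (mem_extremePoints.1 hφ).2 (a⁻¹ • u) (fun f => by
      rw [smul_apply, smul_eq_mul, abs_mul, abs_of_pos (inv_pos.2 ha),
        inv_mul_le_iff₀ ha]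
      exact hu f) ((1 - a)⁻¹ • w) (fun f => by
      rw [smul_apply, smul_eq_mul, abs_mul, abs_of_pos (inv_pos.2 hb),
        inv_mul_le_iff₀ hb]
      exact hw f) ⟨a, 1 - a, ha, hb, by ring, by
        rw [smul_inv_smul₀ ha.ne', smul_inv_smul₀ hb.ne', huw]⟩
  rw [← h.1, smul_inv_smul₀ ha.ne']

theorem neg_mem_extremePoints_functionalBall {φ : StrongDual ℝ Y}
    (hφ : φ ∈ extremePoints ℝ (functionalBall Y)) :
    -φ ∈ extremePoints ℝ (functionalBall Y) := by
  rw [mem_extremePoints] at hφ ⊢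
  refine ⟨neg_mem_functionalBall hφ.1, fun u hu w hw ⟨a, b, ha, hb, hab, h⟩ => ?_⟩
  have := hφ.2 _ (neg_mem_functionalBall hu) _ (neg_mem_functionalBall hw)
    ⟨a, b, ha, hb, hab, by rw [smul_neg, smul_neg, ← neg_add, h, neg_neg]⟩
  exact ⟨by rw [← this.1, neg_neg], by rw [← this.2, neg_neg]⟩

/-- The Krein-Milman theorem for the dual unit ball, which is weak-* compact. -/
theorem apply_le_of_forall_mem_extremePoints {f : Y} {c : ℝ}
    (h : ∀ φ ∈ extremePoints ℝ (functionalBall Y), φ f ≤ c) {φ : StrongDual ℝ Y}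
    (hφ : φ ∈ functionalBall Y) : φ f ≤ c := by
  have : LocallyConvexSpace ℝ (WeakDual ℝ Y) :=
    inferInstanceAs (LocallyConvexSpace ℝ (WeakBilin (topDualPairing ℝ Y)))
  set S : Set (WeakDual ℝ Y) := WeakDual.toStrongDual ⁻¹' functionalBall Y with hS
  have hcomp : IsCompact S := by
    rw [hS, functionalBall_eq_closedBall]
    exact WeakDual.isCompact_closedBall 0 1
  have hconv : Convex ℝ S := by
    rw [hS, functionalBall_eq_closedBall]
    exact (convex_closedBall (0 : StrongDual ℝ Y) 1).linear_preimage
      (WeakDual.toStrongDual (𝕜 := ℝ) (E := Y)).toLinearMap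
  have hext : extremePoints ℝ S ⊆ {φ | φ f ≤ c} := fun φ hφ => h (WeakDual.toStrongDual φ) hφ
  have hhalf : Convex ℝ {φ : WeakDual ℝ Y | φ f ≤ c} :=
    convex_halfSpace_le ⟨fun _ _ => rfl, fun _ _ => rfl⟩ c
  have hclosed : IsClosed {φ : WeakDual ℝ Y | φ f ≤ c} :=
    isClosed_le (WeakDual.eval_continuous f) continuous_const
  have hmem : StrongDual.toWeakDual φ ∈ S := hφ
  rw [← closure_convexHull_extremePoints hcomp hconv] at hmem
  exact closure_minimal (convexHull_min hext hhalf) hclosed hmem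

/-- The Hahn-Banach theorem for an isometric embedding. -/
theorem exists_extension_along (J : Y →ₗᵢ[ℝ] Z) (φ : StrongDual ℝ Y) :
    ∃ ψ : StrongDual ℝ Z, (∀ y, ψ (J y) = φ y) ∧ ‖ψ‖ ≤ ‖φ‖ := by
  let e : Y ≃ₗᵢ[ℝ] LinearMap.range J.toLinearMap := J.equivRange
  obtain ⟨ψ, hψ, hnorm⟩ := _root_.exists_extension_norm_eq (𝕜 := ℝ) (LinearMap.range J.toLinearMap)
    (φ.comp e.symm.toContinuousLinearEquiv.toContinuousLinearMap)
  refine ⟨ψ, fun y => ?_, ?_⟩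
  · have h := hψ (e y)
    change ψ (J y) = φ (e.symm (e y)) at h
    rwa [e.symm_apply_apply] at h
  · rw [hnorm]
    refine ContinuousLinearMap.opNorm_le_bound _ (norm_nonneg _) fun z => ?_
    have h := φ.le_opNorm (e.symm z)
    rwa [e.symm.norm_map] at h

/-- The functional `y ↦ J y x`. -/
def evalAlong (J : Y →ₗᵢ[ℝ] C(K, ℝ)) (x : K) : StrongDual ℝ Y :=
  (ContinuousMap.evalCLM ℝ x).comp J.toContinuousLinearMap

theorem evalAlong_apply (J : Y →ₗᵢ[ℝ] C(K, ℝ)) (x : K) (f : Y) : evalAlong J x f = J f x := rfl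

theorem evalAlong_mem_functionalBall (J : Y →ₗᵢ[ℝ] C(K, ℝ)) (x : K) :
    evalAlong J x ∈ functionalBall Y := fun f => by
  rw [evalAlong_apply, ← J.norm_map]
  exact (J f).norm_coe_le_norm x

theorem norm_le_of_apply_le {ψ : StrongDual ℝ C(K, ℝ)} {c : ℝ} (hc : 0 ≤ c)
    (h : ∀ f, ‖f‖ ≤ 1 → ψ f ≤ c) : ‖ψ‖ ≤ c := by
  refine ContinuousLinearMap.opNorm_le_of_unit_norm hc fun f hf => ?_
  rw [Real.norm_eq_abs]
  refine abs_le'.2 ⟨h f hf.le, ?_⟩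
  rw [← map_neg]
  exact h (-f) (by rw [norm_neg, hf])

/-- The functional `f ↦ ψ (g f)`. -/
def mulFunctional (ψ : StrongDual ℝ C(K, ℝ)) (g : C(K, ℝ)) : StrongDual ℝ C(K, ℝ) :=
  ψ.comp (ContinuousLinearMap.mul ℝ C(K, ℝ) g)

/-- Testing the two functionals on separate `f`, `f'` in the unit ball amounts to testing `ψ` on `g
* f + (1 - g) * f'`, a pointwise convex combination. This replaces additivity of total variation for
a representing measure. -/
theorem norm_mulFunctional_add_le {ψ : StrongDual ℝ C(K, ℝ)} (hψ : ‖ψ‖ ≤ 1) {g : C(K, ℝ)}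
    (hg : ∀ x, g x ∈ Icc (0 : ℝ) 1) :
    ‖mulFunctional ψ g‖ + ‖mulFunctional ψ (1 - g)‖ ≤ 1 := by
  have key : ∀ f f' : C(K, ℝ), ‖f‖ ≤ 1 → ‖f'‖ ≤ 1 →
      mulFunctional ψ g f + mulFunctional ψ (1 - g) f' ≤ 1 := by
    intro f f' hf hf'
    have h1 : mulFunctional ψ g f + mulFunctional ψ (1 - g) f' = ψ (g * f + (1 - g) * f') := by
      rw [map_add]
      rfl
    have h2 : ‖g * f + (1 - g) * f'‖ ≤ 1 := by
      rw [ContinuousMap.norm_le _ zero_le_one]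
      intro x
      have h3 := abs_le.1 ((f.norm_coe_le_norm x).trans hf)
      have h4 := abs_le.1 ((f'.norm_coe_le_norm x).trans hf')
      have h5 := hg x
      simp only [ContinuousMap.add_apply, ContinuousMap.mul_apply, ContinuousMap.sub_apply,
        ContinuousMap.one_apply, Real.norm_eq_abs]
      rw [abs_le]
      constructor <;> nlinarith [h5.1, h5.2]
    rw [h1]
    calc ψ (g * f + (1 - g) * f') ≤ ‖ψ‖ * ‖g * f + (1 - g) * f'‖ :=
          (le_abs_self _).trans (ψ.le_opNorm _)
      _ ≤ 1 * 1 := mul_le_mul hψ h2 (norm_nonneg _) zero_le_one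
      _ = 1 := one_mul 1
  have h1 : ∀ f', ‖f'‖ ≤ 1 → ‖mulFunctional ψ g‖ ≤ 1 - mulFunctional ψ (1 - g) f' := by
    intro f' hf'
    refine norm_le_of_apply_le ?_ fun f hf => ?_
    · have := key 0 f' (by simp) hf'
      rw [map_zero] at this
      linarith
    · linarith [key f f' hf hf']
  have h2 : ‖mulFunctional ψ (1 - g)‖ ≤ 1 - ‖mulFunctional ψ g‖ := by
    refine norm_le_of_apply_le ?_ fun f' hf' => ?_
    · have := h1 0 (by simp)
      rw [map_zero] at this
      linarith
    · linarith [h1 f' hf']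
  linarith

/-- If `g` is supported in `U`, the functional `f ↦ ψ (g f)` only sees the values on `U`. -/
theorem abs_mulFunctional_le {ψ : StrongDual ℝ C(K, ℝ)} {g f : C(K, ℝ)} {U : Set K}
    (hg : tsupport g ⊆ U) {c : ℝ} (hc : 0 ≤ c) (hf : ∀ x ∈ U, |f x| ≤ c) :
    |mulFunctional ψ g f| ≤ ‖mulFunctional ψ g‖ * c := by
  -- Truncating `f` at `±c` leaves it unchanged on `U`, hence does not affect `g * f`.
  set f' : C(K, ℝ) := ⟨fun x => max (-c) (min c (f x)), by fun_prop⟩ with hf'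
  have h1 : mulFunctional ψ g f = mulFunctional ψ g f' := by
    have : g * f = g * f' := by
      ext x
      by_cases hx : x ∈ U
      · have h2 := abs_le.1 (hf x hx)
        simp [hf', min_eq_right h2.2, max_eq_right h2.1]
      · have : g x = 0 := by
          by_contra hne
          exact hx (hg (subset_tsupport _ hne))
        simp [this]
    exact congrArg ψ this
  have h2 : ‖f'‖ ≤ c := by
    rw [ContinuousMap.norm_le _ hc]
    intro x
    rw [Real.norm_eq_abs, abs_le]
    exact ⟨le_max_left _ _, max_le (by linarith) (min_le_left _ _)⟩
  rw [h1]
  exact ((mulFunctional ψ g).le_opNorm f').trans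
    (mul_le_mul_of_nonneg_left h2 (norm_nonneg _))

/-- Extend `φ` to `ψ` on `C(K)`. By extremality every localization of `ψ` by a cutoff `g` restricts
to a multiple of `φ`. Localizing near a point of the support of `ψ` therefore shows that `φ` depends
only on the value there. -/
theorem eq_evalAlong_or_eq_neg_of_mem_extremePoints [T2Space K]
    (J : Y →ₗᵢ[ℝ] C(K, ℝ)) {φ : StrongDual ℝ Y} (hφ : φ ∈ extremePoints ℝ (functionalBall Y)) (hφ0 : φ ≠ 0) :
    ∃ x, φ = evalAlong J x ∨ φ = -evalAlong J x := by
  obtain ⟨ψ, hψφ, hψ⟩ := exists_extension_along J φ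
  have hφ1 : ‖φ‖ ≤ 1 := φ.opNorm_le_bound zero_le_one fun f => by
    simpa using (mem_extremePoints.1 hφ).1 f
  have hψ1 : ‖ψ‖ ≤ 1 := hψ.trans hφ1
  have hmul : ∀ g : C(K, ℝ), (∀ x, g x ∈ Icc (0 : ℝ) 1) → ∀ f : Y,
      mulFunctional ψ g (J f) = ‖mulFunctional ψ g‖ * φ f := by
    intro g hg f
    have hadd := norm_mulFunctional_add_le hψ1 hg
    have h := eq_smul_of_mem_extremePoints hφ
      (u := (mulFunctional ψ g).comp J.toContinuousLinearMap)
      (w := (mulFunctional ψ (1 - g)).comp J.toContinuousLinearMap) (a := ‖mulFunctional ψ g‖) (by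
        ext f
        rw [add_apply, ← hψφ]
        change ψ (J f) = ψ (g * J f) + ψ ((1 - g) * J f)
        rw [← map_add, ← add_mul, add_sub_cancel, one_mul]) (ContinuousLinearMap.opNorm_nonneg _)
      (by linarith [ContinuousLinearMap.opNorm_nonneg (mulFunctional ψ (1 - g))])
      (fun f => by
        rw [← J.norm_map]
        exact (mulFunctional ψ g).le_opNorm (J f))
      (fun f => by
        rw [← J.norm_map]
        exact ((mulFunctional ψ (1 - g)).le_opNorm (J f)).trans
          (mul_le_mul_of_nonneg_right (by linarith) (norm_nonneg _)))
    exact DFunLike.congr_fun h f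
  -- `x` is a support point of `ψ`. If there were none, a partition of unity would give `φ = 0`.
  obtain ⟨x, hx⟩ : ∃ x, ∀ U, IsOpen U → x ∈ U → ∃ g : C(K, ℝ), (∀ x, g x ∈ Icc (0 : ℝ) 1) ∧
      tsupport g ⊆ U ∧ mulFunctional ψ g ≠ 0 := by
    by_contra! hcon
    choose U hUo hxU hU using hcon
    obtain ⟨t, ht⟩ := isCompact_univ.elim_finite_subcover U hUo
      (fun x _ => mem_iUnion.2 ⟨x, hxU x⟩)
    obtain ⟨p, hpsupp, hpsum, hpI, -⟩ := exists_continuous_sum_one_of_isOpen_isCompact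
      (s := fun i : Fin t.card => U (t.equivFin.symm i)) (fun i => hUo _) isCompact_univ (by
        intro x hx
        obtain ⟨y, hy, hxy⟩ := mem_iUnion₂.1 (ht hx)
        exact mem_iUnion.2 ⟨t.equivFin ⟨y, hy⟩, by simpa using hxy⟩)
    refine hφ0 (ContinuousLinearMap.ext fun f => ?_)
    have h1 : J f = ∑ i, p i * J f := by
      rw [← Finset.sum_mul]
      ext y
      have := hpsum (mem_univ y)
      simp only [Finset.sum_apply, Pi.one_apply] at this
      simp [ContinuousMap.sum_apply, this]
    rw [← hψφ, h1, map_sum]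
    exact Finset.sum_eq_zero fun i _ =>
      DFunLike.congr_fun (hU _ (p i) (hpI i) (hpsupp i)) (J f)
  have hle : ∀ f : Y, |φ f| ≤ |J f x| := by
    intro f
    refine le_of_forall_pos_le_add fun ε hε => ?_
    obtain ⟨g, hg, hgU, hg0⟩ := hx {y | |J f y| < |J f x| + ε}
      (isOpen_lt (J f).continuous.abs continuous_const) (by simpa using hε)
    have h1 := abs_mulFunctional_le (ψ := ψ) hgU (f := J f) (c := |J f x| + ε)
      (by positivity) (fun y hy => le_of_lt hy)
    have hpos : 0 < ‖mulFunctional ψ g‖ := by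
      refine (ContinuousLinearMap.opNorm_nonneg _).lt_of_ne' fun h0 => hg0 ?_
      ext f'
      have h2 := (mulFunctional ψ g).le_opNorm f'
      rw [h0, zero_mul] at h2
      exact norm_le_zero_iff.1 h2
    rw [hmul g hg f, abs_mul, abs_of_pos hpos] at h1
    exact le_of_mul_le_mul_left h1 hpos
  obtain ⟨f₀, hf₀⟩ : ∃ f, φ f ≠ 0 := by
    by_contra! h
    exact hφ0 (ContinuousLinearMap.ext h)
  have hf₀x : J f₀ x ≠ 0 := fun h => hf₀ (by simpa [h] using hle f₀)
  set c : ℝ := φ f₀ / J f₀ x with hcdef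
  have hc : |c| ≤ 1 := by
    rw [hcdef, abs_div, div_le_one (abs_pos.2 hf₀x)]
    exact hle f₀
  have hφc : φ = c • evalAlong J x := by
    ext f
    change φ f = c * J f x
    have h1 := hle (f - (J f x / J f₀ x) • f₀)
    have h2 : J (f - (J f x / J f₀ x) • f₀) x = 0 := by
      simp [hf₀x]
    rw [h2, abs_zero, abs_nonpos_iff, map_sub, map_smul, smul_eq_mul, sub_eq_zero] at h1
    rw [h1, hcdef]
    ring
  refine ⟨x, ?_⟩
  have hc' := abs_le.1 hc
  rcases hc'.2.eq_or_lt with h | h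
  · left
    rw [hφc, h, one_smul]
  rcases hc'.1.eq_or_lt with h' | h'
  · right
    rw [hφc, ← h']
    ext f
    change (-1 : ℝ) * J f x = -J f x
    ring
  -- Here `|c| < 1`, so `φ` lies strictly between the two signed evaluations and extremality makes
  -- it equal to one of them.
  left
  exact ((mem_extremePoints.1 hφ).2 _ (evalAlong_mem_functionalBall J x) _
    (neg_mem_functionalBall (evalAlong_mem_functionalBall J x))
    ⟨(1 + c) / 2, (1 - c) / 2, by linarith, by linarith, by ring, by
      rw [hφc]
      ext f
      change (1 + c) / 2 * J f x + (1 - c) / 2 * -J f x = c * J f x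
      ring⟩).1.symm

theorem norm_le_of_forall_mem_choquetBoundary_scalar [T2Space K] (H : Submodule ℝ C(K, E))
    {f : C(K, ℝ)} (hf : f ∈ scalarSpace H) {c : ℝ} (hc : 0 ≤ c)
    (h : ∀ x ∈ choquetBoundary H, |f x| ≤ c) : ‖f‖ ≤ c := by
  have hext : ∀ φ ∈ extremePoints ℝ (functionalBall (scalarSpace H)), φ ⟨f, hf⟩ ≤ c := by
    intro φ hφ
    by_cases hφ0 : φ = 0
    · simpa [hφ0] using hc
    obtain ⟨x, rfl | rfl⟩ := eq_evalAlong_or_eq_neg_of_mem_extremePoints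
      (scalarSpace H).subtypeₗᵢ hφ hφ0
    · exact (abs_le.1 (h x hφ)).2
    · have h1 : x ∈ choquetBoundary H := by
        have := neg_mem_extremePoints_functionalBall hφ
        rwa [neg_neg] at this
      have h2 := (abs_le.1 (h x h1)).1
      change -(f x) ≤ c
      linarith
  rw [ContinuousMap.norm_le _ hc]
  intro x
  have hx := evalAlong_mem_functionalBall (Y := scalarSpace H) (scalarSpace H).subtypeₗᵢ x
  have h1 := apply_le_of_forall_mem_extremePoints hext hx
  have h2 := apply_le_of_forall_mem_extremePoints hext (neg_mem_functionalBall hx)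
  exact abs_le'.2 ⟨h1, h2⟩

theorem dualComp_mem_scalarSpace {H : Submodule ℝ C(K, E)} {g : C(K, E)} (hg : g ∈ H)
    (e' : StrongDual ℝ E) : dualComp e' g ∈ scalarSpace H :=
  Submodule.le_topologicalClosure _ (Submodule.subset_span ⟨e', g, hg, rfl⟩)

/-- The Choquet boundary of `H` is norming for `H`. -/
theorem norm_le_of_forall_mem_choquetBoundary [T2Space K] {H : Submodule ℝ C(K, E)}
    {g : C(K, E)} (hg : g ∈ H) {c : ℝ} (hc : 0 ≤ c)
    (h : ∀ x ∈ choquetBoundary H, ‖g x‖ ≤ c) : ‖g‖ ≤ c := by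
  rw [ContinuousMap.norm_le _ hc]
  intro x
  obtain ⟨e', he', hx⟩ := exists_dual_vector'' ℝ (g x)
  have h1 : ‖dualComp e' g‖ ≤ c := by
    refine norm_le_of_forall_mem_choquetBoundary_scalar H (dualComp_mem_scalarSpace hg e') hc
      fun y hy => ?_
    exact ((e'.le_opNorm (g y)).trans (mul_le_of_le_one_left (norm_nonneg _) he')).trans (h y hy)
  have h2 := (dualComp e' g).norm_coe_le_norm x
  change ‖e' (g x)‖ ≤ _ at h2
  rw [hx] at h2
  simpa using h2.trans h1

end ChoquetBoundary

/-! ### Disjoint neighbourhoods and peak functions. -/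

/-- Recursively separate a point of `S` from `p` and continue inside the remaining neighbourhood of
`p`. -/
theorem exists_seq_disjoint_nhds {X : Type*} [TopologicalSpace X] [T2Space X] {p : X} {S : Set X}
    (hp : AccPt p (Filter.principal S)) : ∃ (x : ℕ → X) (V : ℕ → Set X),
      (∀ n, x n ∈ S ∧ IsOpen (V n) ∧ x n ∈ V n) ∧ Pairwise (Function.onFun Disjoint V) := by
  have step : ∀ O : {O : Set X // O ∈ 𝓝 p}, ∃ (x : X) (V : Set X) (O' : {O : Set X // O ∈ 𝓝 p}),
      x ∈ S ∧ IsOpen V ∧ x ∈ V ∧ V ⊆ O ∧ O'.1 ⊆ O ∧ Disjoint V O' := by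
    rintro ⟨O, hO⟩
    obtain ⟨x, ⟨hxO, hxS⟩, hxp⟩ := accPt_iff_nhds.1 hp (interior O) (interior_mem_nhds.2 hO)
    obtain ⟨V, W, hV, hW, hxV, hpW, hVW⟩ := t2_separation hxp
    exact ⟨x, V ∩ interior O, ⟨W ∩ O, Filter.inter_mem (hW.mem_nhds hpW) hO⟩, hxS,
      hV.inter isOpen_interior, ⟨hxV, hxO⟩, inter_subset_right.trans interior_subset,
      inter_subset_right, hVW.mono inter_subset_left inter_subset_left⟩
  choose x V next hx hV hxV hVO hnext hdisj using step
  let O : ℕ → {O : Set X // O ∈ 𝓝 p} := fun n => next^[n] ⟨univ, Filter.univ_mem⟩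
  have hO : ∀ n, O (n + 1) = next (O n) := fun n => Function.iterate_succ_apply' _ _ _
  have hanti : Antitone fun n => (O n).1 := antitone_nat_of_succ_le fun n => by
    rw [hO]
    exact hnext _
  refine ⟨fun n => x (O n), fun n => V (O n), fun n => ⟨hx _, hV _, hxV _⟩, ?_⟩
  rw [pairwise_disjoint_on]
  intro m n hmn
  refine (hdisj (O m)).mono_right ((hVO (O n)).trans ?_)
  rw [← hO]
  exact hanti hmn

/-- At most one of the disjoint sets contains `x`; its term costs 1, every other term its error. -/
theorem sum_le_one_add_of_disjoint {ι X : Type*} {V : ι → Set X}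
    (hV : Pairwise (Function.onFun Disjoint V)) {f : ι → X → ℝ} {ε : ι → ℝ} {x : X}
    (hε : ∀ i, 0 ≤ ε i) (hf1 : ∀ i, f i x ≤ 1) (hf : ∀ i, x ∉ V i → f i x ≤ ε i) (s : Finset ι) :
    ∑ i ∈ s, f i x ≤ 1 + ∑ i ∈ s, ε i := by
  classical
  by_cases h : ∃ j ∈ s, x ∈ V j
  · obtain ⟨j, hj, hxj⟩ := h
    rw [← Finset.add_sum_erase s _ hj]
    refine add_le_add (hf1 j) ((Finset.sum_le_sum fun i hi => hf i fun hxi => ?_).trans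
      (Finset.sum_le_sum_of_subset_of_nonneg (Finset.erase_subset _ _) fun i _ _ => hε i))
    exact disjoint_left.1 (hV (Finset.ne_of_mem_erase hi)) hxi hxj
  · push Not at h
    have := Finset.sum_le_sum fun i hi => hf i (h i hi)
    linarith

section Peaks

variable {K E : Type*} [TopologicalSpace K] [CompactSpace K] [NormedAddCommGroup E]
  [NormedSpace ℝ E]

/-- The function `h ⊗ e` as an element of `H`. -/
def tensorIn {H : Submodule ℝ C(K, E)} (h : tensorSpace H) (e : E) : H :=
  ⟨tensor h e, h.2.2 e⟩

theorem tensorIn_apply {H : Submodule ℝ C(K, E)} (h : tensorSpace H) (e : E) (t : K) :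
    (tensorIn h e : C(K, E)) t = (h : C(K, ℝ)) t • e := rfl

/-- The function `h` peaks at `x`, and it is small on the Choquet boundary outside of `U`. -/
structure PeaksAt (H : Submodule ℝ C(K, E)) (h : C(K, ℝ)) (x : K) (U : Set K) (ε : ℝ) : Prop where
  nonneg : ∀ t, 0 ≤ h t
  le_one : ∀ t, h t ≤ 1
  lt_apply : 1 - ε < h x
  lt_of_notMem : ∀ t ∈ choquetBoundary H, t ∉ U → h t < ε

theorem PeaksAt.mono {H : Submodule ℝ C(K, E)} {h : C(K, ℝ)} {x : K} {U U' : Set K} {ε ε' : ℝ}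
    (hp : PeaksAt H h x U ε) (hU : U ⊆ U') (hε : ε ≤ ε') : PeaksAt H h x U' ε' :=
  ⟨hp.nonneg, hp.le_one, by linarith [hp.lt_apply],
    fun t ht htU => (hp.lt_of_notMem t ht fun h => htU (hU h)).trans_le hε⟩

theorem exists_peaksAt {H : Submodule ℝ C(K, E)} {x : K} (hx : x ∈ weakPeakPoints H) {U : Set K}
    (hU : U ∈ 𝓝 x) {ε : ℝ} (hε : 0 < ε) (hε1 : ε < 1) :
    ∃ h : tensorSpace H, PeaksAt H h x U ε := by
  obtain ⟨h, hh, h1, h2, h3⟩ := hx U hU ε hε hε1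
  exact ⟨⟨h, hh⟩, fun t => (h1 t).1, fun t => (h1 t).2, h2, fun t ht htU => h3 t ⟨ht, htU⟩⟩

/-- Otherwise a function peaking at `x` would be small on the whole Choquet boundary, which is
norming, yet close to 1 at `x`. -/
theorem weakPeakPoints_subset_closure [T2Space K] (H : Submodule ℝ C(K, E)) :
    weakPeakPoints H ⊆ closure (choquetBoundary H) := by
  intro x hx
  rw [mem_closure_iff_nhds]
  intro U hU
  obtain ⟨h, hh⟩ := exists_peaksAt hx hU (ε := 1 / 2) (by norm_num) (by norm_num)
  by_contra hne
  have h1 : ‖(h : C(K, ℝ))‖ ≤ 1 / 2 := by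
    refine norm_le_of_forall_mem_choquetBoundary_scalar H h.2.1 (by norm_num) fun t ht => ?_
    rw [abs_of_nonneg (hh.nonneg t)]
    exact (hh.lt_of_notMem t ht fun htU => hne ⟨t, htU, ht⟩).le
  have h2 := (h : C(K, ℝ)).norm_coe_le_norm x
  rw [Real.norm_of_nonneg (hh.nonneg x)] at h2
  linarith [hh.lt_apply]

end Peaks

theorem iteratedDerivedSet_subset {X : Type*} [TopologicalSpace X] (S : Set X) (α : Ordinal) :
    iteratedDerivedSet S α ⊆ S := by
  have := iteratedDerivedSet_antitone S (zero_le (a := α))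
  rwa [iteratedDerivedSet_zero] at this

/-! ### Large values of images of peak functions, and the transfinite induction. -/

section LargeSet

variable {K₁ K₂ E₁ E₂ : Type*} [TopologicalSpace K₁] [CompactSpace K₁] [TopologicalSpace K₂]
  [NormedAddCommGroup E₁] [NormedSpace ℝ E₁] [NormedAddCommGroup E₂] [NormedSpace ℝ E₂]
  {H : Submodule ℝ C(K₁, E₁)}

/-- The points at which `τ f₀` and all `τ (h ⊗ e)`, `h ∈ F`, are large. -/
def largeSet (τ : H →ₗ[ℝ] C(K₂, E₂)) (δ : ℝ) (e : E₁) (f₀ : H) (F : Set (tensorSpace H)) :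
    Set K₂ :=
  {y | δ ≤ ‖τ f₀ y‖ ∧ ∀ h ∈ F, δ ≤ ‖τ (tensorIn h e) y‖}

theorem isClosed_largeSet (τ : H →ₗ[ℝ] C(K₂, E₂)) (δ : ℝ) (e : E₁) (f₀ : H)
    (F : Set (tensorSpace H)) : IsClosed (largeSet τ δ e f₀ F) := by
  have h : largeSet τ δ e f₀ F
      = {y | δ ≤ ‖τ f₀ y‖} ∩ ⋂ h ∈ F, {y | δ ≤ ‖τ (tensorIn h e) y‖} := by
    ext y
    simp [largeSet]
  rw [h]
  exact (isClosed_le continuous_const (τ f₀).continuous.norm).inter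
    (isClosed_biInter fun h _ => isClosed_le continuous_const (τ (tensorIn h e)).continuous.norm)

end LargeSet

section Embedding

variable {K₁ K₂ : Type u} {E₁ E₂ : Type*} [TopologicalSpace K₁] [CompactSpace K₁] [T2Space K₁]
  [TopologicalSpace K₂] [CompactSpace K₂]
  [NormedAddCommGroup E₁] [NormedSpace ℝ E₁] [NormedAddCommGroup E₂] [NormedSpace ℝ E₂]

/-- The operator `τ` has norm at most `L`, and it is bounded from below by `1` with respect to
the supremum norm on `B`. -/
structure NormingOn {H : Submodule ℝ C(K₁, E₁)} (τ : H →ₗ[ℝ] C(K₂, E₂)) (B : Set K₂) (L : ℝ) :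
    Prop where
  nonneg : 0 ≤ L
  norm_le : ∀ g, ‖τ g‖ ≤ L * ‖(g : C(K₁, E₁))‖
  le_of_forall_mem : ∀ g c, 0 ≤ c → (∀ y ∈ B, ‖τ g y‖ ≤ c) → ‖(g : C(K₁, E₁))‖ ≤ c

variable {H : Submodule ℝ C(K₁, E₁)} {τ : H →ₗ[ℝ] C(K₂, E₂)} {B : Set K₂} {L : ℝ}

theorem NormingOn.norm_apply_le (hτ : NormingOn τ B L) (g : H) {c : ℝ} (hc : 0 ≤ c)
    (hg : ∀ t ∈ choquetBoundary H, ‖(g : C(K₁, E₁)) t‖ ≤ c) (y : K₂) : ‖τ g y‖ ≤ L * c :=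
  ((τ g).norm_coe_le_norm y).trans ((hτ.norm_le g).trans
    (mul_le_mul_of_nonneg_left (norm_le_of_forall_mem_choquetBoundary g.2 hc hg) hτ.nonneg))

/-- Disjointness and the geometric errors bound all signed partial sums of `h n ⊗ e` by `1 + 2 = 3`
on the Choquet boundary. Their images at `y` thus form a weakly unconditionally Cauchy series in
`E₂`. -/
theorem finite_setOf_le_apply [CompleteSpace E₂] (hE₂ : ¬ ContainsC0 E₂) (hτ : NormingOn τ B L)
    {h : ℕ → tensorSpace H} {x : ℕ → K₁} {V : ℕ → Set K₁}
    (hV : Pairwise (Function.onFun Disjoint V))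
    (hh : ∀ n, PeaksAt H (h n) (x n) (V n) ((1 / 2) ^ n)) {e : E₁} (he : ‖e‖ = 1) {δ : ℝ}
    (hδ : 0 < δ) (y : K₂) : {n | δ ≤ ‖τ (tensorIn (h n) e) y‖}.Finite := by
  refine finite_setOf_le_norm hE₂ (C := L * 3) hδ fun s a ha => ?_
  have h1 : ∑ n ∈ s, a n • τ (tensorIn (h n) e) y = τ (∑ n ∈ s, a n • tensorIn (h n) e) y := by
    simp [map_sum, ContinuousMap.sum_apply]
  rw [h1]
  refine hτ.norm_apply_le _ (by norm_num) (fun t ht => ?_) y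
  have h2 : ((∑ n ∈ s, a n • tensorIn (h n) e : H) : C(K₁, E₁)) t
      = ∑ n ∈ s, (a n * (h n : C(K₁, ℝ)) t) • e := by
    simp [ContinuousMap.sum_apply, tensorIn_apply, mul_smul]
  rw [h2]
  calc ‖∑ n ∈ s, (a n * (h n : C(K₁, ℝ)) t) • e‖
      ≤ ∑ n ∈ s, (h n : C(K₁, ℝ)) t := by
        refine norm_sum_le_of_le s fun n _ => ?_
        rw [norm_smul, he, mul_one, norm_mul, Real.norm_of_nonneg ((hh n).nonneg t)]
        exact mul_le_of_le_one_left ((hh n).nonneg t) (ha n)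
    _ ≤ 1 + ∑ n ∈ s, (1 / 2 : ℝ) ^ n :=
        sum_le_one_add_of_disjoint hV (f := fun n => (h n : C(K₁, ℝ))) (fun n => by positivity)
          (fun n => (hh n).le_one t) (fun n htn => ((hh n).lt_of_notMem t ht htn).le) s
    _ ≤ 3 := by
        have := summable_geometric_two.sum_le_tsum s (fun n _ => by positivity)
        rw [tsum_geometric_two] at this
        linarith

/-- The only place where the constant 3 matters: `f₀ + 2 k ⊗ e` has norm nearly 3 at `x`, but
differs from a function of norm nearly 1 by twice a function whose image at `y` is small. -/
theorem exists_mem_forall_le_norm (hτ : NormingOn τ B L) {δ ε : ℝ} (hε : 0 < ε) (hε1 : ε < 1)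
    (hδε : L * (1 + 3 * ε) + 2 * δ < 3 - 3 * ε) (hδ : 0 < δ) {e : E₁} (he : ‖e‖ = 1) {f₀ : H}
    (hf₀ : ∀ t ∈ choquetBoundary H, ‖(f₀ : C(K₁, E₁)) t‖ ≤ 1 + ε) {U : Set K₁} (hU : IsOpen U)
    (hf₀U : ∀ t ∈ U, ‖(f₀ : C(K₁, E₁)) t - e‖ ≤ ε) {x : K₁} (hx : x ∈ weakPeakPoints H)
    (hxU : x ∈ U) (F : Finset (tensorSpace H)) (hF : ∀ h ∈ F, PeaksAt H h x U ε) :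
    ∃ y ∈ B, δ ≤ ‖τ f₀ y‖ ∧ ∀ h ∈ F, δ ≤ ‖τ (tensorIn h e) y‖ := by
  by_contra! hcon
  -- Peaking where every `h ∈ F` exceeds `1 - ε` ensures that, on the Choquet boundary, `k` is small
  -- wherever some `h` is not near 1. This keeps `1 - 2h + 2k` between `-1` and `1 + 2ε`.
  obtain ⟨k, hk⟩ := exists_peaksAt hx (U := U ∩ ⋂ h ∈ F, {t | 1 - ε < (h : C(K₁, ℝ)) t})
    (Filter.inter_mem (hU.mem_nhds hxU) ((Filter.biInter_finset_mem F).2 fun h hh =>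
      (isOpen_lt continuous_const (h : C(K₁, ℝ)).continuous).mem_nhds (hF h hh).lt_apply))
    hε hε1
  have hL := hτ.nonneg
  have hnorm : ∀ c : ℝ, ‖c • e‖ = |c| := fun c => by rw [norm_smul, he, mul_one, Real.norm_eq_abs]
  have hbound : ∀ y ∈ B, ‖τ (f₀ + (2 : ℝ) • tensorIn k e) y‖ ≤ L * (1 + 3 * ε) + 2 * δ := by
    intro y hy
    by_cases hy0 : δ ≤ ‖τ f₀ y‖
    · obtain ⟨h, hh, hhy⟩ := hcon y hy hy0
      have hhF := hF h hh
      have h1 : ‖τ (f₀ - (2 : ℝ) • tensorIn h e + (2 : ℝ) • tensorIn k e) y‖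
          ≤ L * (1 + 3 * ε) := by
        refine hτ.norm_apply_le _ (by positivity) (fun t ht => ?_) y
        change ‖(f₀ : C(K₁, E₁)) t - (2 : ℝ) • (h : C(K₁, ℝ)) t • e
          + (2 : ℝ) • (k : C(K₁, ℝ)) t • e‖ ≤ _
        have hh0 := hhF.nonneg t
        have hh1 := hhF.le_one t
        have hk0 := hk.nonneg t
        have hk1 := hk.le_one t
        by_cases htU : t ∈ U
        · have h2 : (f₀ : C(K₁, E₁)) t - (2 : ℝ) • (h : C(K₁, ℝ)) t • e
              + (2 : ℝ) • (k : C(K₁, ℝ)) t • e = ((f₀ : C(K₁, E₁)) t - e)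
              + (1 - 2 * (h : C(K₁, ℝ)) t + 2 * (k : C(K₁, ℝ)) t) • e := by
            module
          rw [h2]
          refine (norm_add_le _ _).trans ?_
          rw [hnorm]
          have h3 : |1 - 2 * (h : C(K₁, ℝ)) t + 2 * (k : C(K₁, ℝ)) t| ≤ 1 + 2 * ε := by
            rw [abs_le]
            by_cases hth : 1 - ε < (h : C(K₁, ℝ)) t
            · constructor <;> linarith
            · have := hk.lt_of_notMem t ht fun h => hth (mem_iInter₂.1 h.2 _ hh)
              constructor <;> linarith
          linarith [hf₀U t htU]
        · have h2 : (f₀ : C(K₁, E₁)) t - (2 : ℝ) • (h : C(K₁, ℝ)) t • e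
              + (2 : ℝ) • (k : C(K₁, ℝ)) t • e = (f₀ : C(K₁, E₁)) t
              + (2 * (k : C(K₁, ℝ)) t - 2 * (h : C(K₁, ℝ)) t) • e := by
            module
          rw [h2]
          refine (norm_add_le _ _).trans ?_
          rw [hnorm]
          have h3 : |2 * (k : C(K₁, ℝ)) t - 2 * (h : C(K₁, ℝ)) t| ≤ 2 * ε := by
            have h4 := hhF.lt_of_notMem t ht htU
            have h5 := hk.lt_of_notMem t ht fun h => htU h.1
            rw [abs_le]
            constructor <;> linarith
          linarith [hf₀ t ht]
      have h2 : τ (f₀ + (2 : ℝ) • tensorIn k e) y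
          = τ (f₀ - (2 : ℝ) • tensorIn h e + (2 : ℝ) • tensorIn k e) y
            + (2 : ℝ) • τ (tensorIn h e) y := by
        simp only [map_add, map_sub, map_smul, ContinuousMap.add_apply, ContinuousMap.sub_apply,
          ContinuousMap.smul_apply]
        module
      rw [h2]
      refine (norm_add_le _ _).trans ?_
      rw [norm_smul, Real.norm_of_nonneg (by norm_num : (0 : ℝ) ≤ 2)]
      linarith
    · have h1 : ‖τ ((2 : ℝ) • tensorIn k e - f₀) y‖ ≤ L * (1 + 3 * ε) := by
        refine hτ.norm_apply_le _ (by positivity) (fun t ht => ?_) y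
        change ‖(2 : ℝ) • (k : C(K₁, ℝ)) t • e - (f₀ : C(K₁, E₁)) t‖ ≤ _
        have hk0 := hk.nonneg t
        have hk1 := hk.le_one t
        by_cases htU : t ∈ U
        · have h2 : (2 : ℝ) • (k : C(K₁, ℝ)) t • e - (f₀ : C(K₁, E₁)) t
              = (2 * (k : C(K₁, ℝ)) t - 1) • e - ((f₀ : C(K₁, E₁)) t - e) := by
            module
          rw [h2]
          refine (norm_sub_le _ _).trans ?_
          rw [hnorm]
          have h3 : |2 * (k : C(K₁, ℝ)) t - 1| ≤ 1 := by
            rw [abs_le]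
            constructor <;> linarith
          linarith [hf₀U t htU]
        · refine (norm_sub_le _ _).trans ?_
          rw [smul_smul, hnorm, abs_of_nonneg (by positivity)]
          linarith [hk.lt_of_notMem t ht fun h => htU h.1, hf₀ t ht]
      have h2 : τ (f₀ + (2 : ℝ) • tensorIn k e) y
          = τ ((2 : ℝ) • tensorIn k e - f₀) y + (2 : ℝ) • τ f₀ y := by
        simp only [map_add, map_sub, map_smul, ContinuousMap.add_apply, ContinuousMap.sub_apply,
          ContinuousMap.smul_apply]
        module
      rw [h2]
      refine (norm_add_le _ _).trans ?_
      rw [norm_smul, Real.norm_of_nonneg (by norm_num : (0 : ℝ) ≤ 2)]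
      linarith
  have h1 := hτ.le_of_forall_mem _ _ (by positivity) hbound
  have h2 := (f₀ + (2 : ℝ) • tensorIn k e : H).1.norm_coe_le_norm x
  change ‖(f₀ : C(K₁, E₁)) x + (2 : ℝ) • (k : C(K₁, ℝ)) x • e‖ ≤ _ at h2
  have h3 : (1 + 2 * (k : C(K₁, ℝ)) x) • e
      = ((f₀ : C(K₁, E₁)) x + (2 : ℝ) • (k : C(K₁, ℝ)) x • e) - ((f₀ : C(K₁, E₁)) x - e) := by
    module
  have h4 := norm_sub_le ((f₀ : C(K₁, E₁)) x + (2 : ℝ) • (k : C(K₁, ℝ)) x • e)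
    ((f₀ : C(K₁, E₁)) x - e)
  rw [← h3, hnorm, abs_of_nonneg (by linarith [hk.nonneg x])] at h4
  linarith [hk.lt_apply, hf₀U x hxU]

/-- The finite set `F` is part of the induction claim so that at a successor a new peak function can
be adjoined to it, forcing the partner to be large for that function too. At limits, closedness and
compactness suffice. -/
theorem nonempty_inter_largeSet [CompleteSpace E₂] (hE₂ : ¬ ContainsC0 E₂)
    (hB : IsClosed B) (hτ : NormingOn τ B L) {δ ε : ℝ} (hε : 0 < ε) (hε1 : ε < 1)
    (hδε : L * (1 + 3 * ε) + 2 * δ < 3 - 3 * ε) (hδ : 0 < δ) {e : E₁} (he : ‖e‖ = 1) {f₀ : H}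
    (hf₀ : ∀ t ∈ choquetBoundary H, ‖(f₀ : C(K₁, E₁)) t‖ ≤ 1 + ε) {U : Set K₁} (hU : IsOpen U)
    (hf₀U : ∀ t ∈ U, ‖(f₀ : C(K₁, E₁)) t - e‖ ≤ ε) (α : Ordinal) :
    ∀ x ∈ iteratedDerivedSet (weakPeakPoints H) α, x ∈ U → ∀ F : Finset (tensorSpace H),
      (∀ h ∈ F, PeaksAt H h x U ε) →
      (iteratedDerivedSet B α ∩ largeSet τ δ e f₀ F).Nonempty := by
  induction α using Ordinal.limitRecOn with
  | zero =>
    intro x hx hxU F hF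
    rw [iteratedDerivedSet_zero] at hx ⊢
    obtain ⟨y, hy, h1, h2⟩ :=
      exists_mem_forall_le_norm hτ hε hε1 hδε hδ he hf₀ hU hf₀U hx hxU F hF
    exact ⟨y, hy, h1, h2⟩
  | add_one α ih =>
    intro x hx hxU F hF
    classical
    rw [iteratedDerivedSet_succ, relDerivedSet_apply] at hx ⊢
    set D := iteratedDerivedSet B α ∩ largeSet τ δ e f₀ F with hD
    have hDclosed : IsClosed D :=
      (isClosed_iteratedDerivedSet hB α).inter (isClosed_largeSet τ δ e f₀ F)
    by_cases hfin : D.Finite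
    · exfalso
      set O : Set K₁ := U ∩ ⋂ h ∈ F, {t | 1 - ε < (h : C(K₁, ℝ)) t} with hO
      have hOx : O ∈ 𝓝 x := Filter.inter_mem (hU.mem_nhds hxU)
        ((Filter.biInter_finset_mem F).2 fun h hh =>
          (isOpen_lt continuous_const (h : C(K₁, ℝ)).continuous).mem_nhds (hF h hh).lt_apply)
      obtain ⟨z, V, hz, hV⟩ := exists_seq_disjoint_nhds (AccPt.nhds_inter hx.1 hOx)
      have hpeak : ∀ n, ∃ h : tensorSpace H, PeaksAt H h (z n) (V n ∩ U) (ε * (1 / 2) ^ n) := by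
        intro n
        have hpow : (1 / 2 : ℝ) ^ n ≤ 1 := pow_le_one₀ (by norm_num) (by norm_num)
        exact exists_peaksAt (iteratedDerivedSet_subset _ _ (hz n).1.2)
          (Filter.inter_mem ((hz n).2.1.mem_nhds (hz n).2.2) (hU.mem_nhds (hz n).1.1.1))
          (by positivity) ((mul_le_of_le_one_right hε.le hpow).trans_lt hε1)
      choose h hh using hpeak
      have hlarge : ∀ n, ∃ y ∈ D, δ ≤ ‖τ (tensorIn (h n) e) y‖ := by
        intro n
        have hpow : (1 / 2 : ℝ) ^ n ≤ 1 := pow_le_one₀ (by norm_num) (by norm_num)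
        obtain ⟨y, hyB, hy0, hyF⟩ := ih (z n) (hz n).1.2 (hz n).1.1.1 (insert (h n) F) (by
          intro k hk
          rcases Finset.mem_insert.1 hk with rfl | hk
          · exact (hh n).mono inter_subset_right (mul_le_of_le_one_right hε.le hpow)
          · exact ⟨(hF k hk).nonneg, (hF k hk).le_one, mem_iInter₂.1 (hz n).1.1.2 k hk,
              (hF k hk).lt_of_notMem⟩)
        exact ⟨y, ⟨hyB, hy0, fun k hk => hyF k (by simpa using Or.inr hk)⟩, hyF _ (by simp)⟩
      have hunion : (⋃ y ∈ D, {n | δ ≤ ‖τ (tensorIn (h n) e) y‖}).Finite :=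
        hfin.biUnion fun y _ => finite_setOf_le_apply hE₂ hτ hV
          (fun n => (hh n).mono inter_subset_left
            (mul_le_of_le_one_left (by positivity) hε1.le)) he hδ y
      refine infinite_univ (hunion.subset fun n _ => ?_)
      obtain ⟨y, hy, hny⟩ := hlarge n
      exact mem_iUnion₂.2 ⟨y, hy, hny⟩
    · obtain ⟨y, hyD, hy⟩ :=
        Set.Infinite.exists_accPt_of_subset_isCompact hfin hDclosed.isCompact Subset.rfl
      exact ⟨y, ⟨hy.mono (Filter.principal_mono.2 inter_subset_left), hyD.1⟩, hyD.2⟩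
  | limit α hα ih =>
    intro x hx hxU F hF
    rw [iteratedDerivedSet_limit hα] at hx ⊢
    have : Nonempty (Iio α) := ⟨⟨0, hα.bot_lt⟩⟩
    rw [iInter_inter]
    refine IsCompact.nonempty_iInter_of_directed_nonempty_isCompact_isClosed _ ?_ ?_ ?_ ?_
    · refine directed_of_isDirected_le fun b c hbc => ?_
      exact inter_subset_inter_left _ (iteratedDerivedSet_antitone B hbc)
    · intro b
      exact ih b b.2 x (mem_iInter.1 hx b) hxU F hF
    · intro b
      exact ((isClosed_iteratedDerivedSet hB b).inter (isClosed_largeSet τ δ e f₀ F)).isCompact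
    · intro b
      exact (isClosed_iteratedDerivedSet hB b).inter (isClosed_largeSet τ δ e f₀ F)

theorem exists_mem_largeSet [CompleteSpace E₂] (hE₂ : ¬ ContainsC0 E₂)
    (hB : IsClosed B) (hτ : NormingOn τ B L) {δ ε : ℝ} (hε : 0 < ε) (hε1 : ε < 1)
    (hδε : L * (1 + 3 * ε) + 2 * δ < 3 - 3 * ε) (hδ : 0 < δ) {e : E₁} (he : ‖e‖ = 1) {f₀ : H}
    (hf₀ : ∀ t ∈ choquetBoundary H, ‖(f₀ : C(K₁, E₁)) t‖ ≤ 1 + ε) {U : Set K₁} (hU : IsOpen U)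
    (hf₀U : ∀ t ∈ U, ‖(f₀ : C(K₁, E₁)) t - e‖ ≤ ε) (α : Ordinal) {x : K₁}
    (hx : x ∈ iteratedDerivedSet (weakPeakPoints H) α) (hxU : x ∈ U) :
    ∃ y ∈ iteratedDerivedSet B α, δ ≤ ‖τ f₀ y‖ ∧
      ∀ h : tensorSpace H, PeaksAt H h x U ε → δ ≤ ‖τ (tensorIn h e) y‖ := by
  classical
  have key := nonempty_inter_largeSet hE₂ hB hτ hε hε1 hδε hδ he hf₀ hU hf₀U α x hx hxU
  obtain ⟨y, hy, hyF⟩ := IsCompact.inter_iInter_nonempty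
    (isClosed_iteratedDerivedSet hB α).isCompact
    (fun h : {h : tensorSpace H // PeaksAt H h x U ε} => largeSet τ δ e f₀ {h.1})
    (fun h => isClosed_largeSet τ δ e f₀ _) (by
      intro u
      obtain ⟨y, hy, hy0, hyF⟩ := key (u.image Subtype.val) (by
        intro h hh
        obtain ⟨k, -, rfl⟩ := Finset.mem_image.1 hh
        exact k.2)
      refine ⟨y, hy, mem_iInter₂.2 fun h hh => ⟨hy0, ?_⟩⟩
      rintro _ rfl
      exact hyF _ (Finset.mem_coe.2 (Finset.mem_image_of_mem _ hh)))
  -- An actual index is needed: the bound on `τ f₀ y` is read off from a member of the intersected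
  -- family.
  obtain ⟨k, hk⟩ := exists_peaksAt (iteratedDerivedSet_subset _ _ hx) (hU.mem_nhds hxU) hε hε1
  exact ⟨y, hy, (mem_iInter.1 hyF ⟨k, hk⟩).1, fun h hh => (mem_iInter.1 hyF ⟨h, hh⟩).2 h rfl⟩

end Embedding

/-! ### Rescaling the isomorphism. -/

section Normalization

variable {K₁ K₂ : Type u} {E₁ E₂ : Type*} [TopologicalSpace K₁] [CompactSpace K₁]
  [TopologicalSpace K₂] [CompactSpace K₂]
  [NormedAddCommGroup E₁] [NormedSpace ℝ E₁] [NormedAddCommGroup E₂] [NormedSpace ℝ E₂]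
  {H : Submodule ℝ C(K₁, E₁)} {τ : H →ₗ[ℝ] C(K₂, E₂)} {B : Set K₂} {L : ℝ}

theorem NormingOn.exists_constants (hτ : NormingOn τ B L) (hL : L < 3) : ∃ δ ε : ℝ,
    0 < δ ∧ 0 < ε ∧ ε < 1 ∧ L * (1 + 3 * ε) + 2 * δ < 3 - 3 * ε := by
  have := hτ.nonneg
  refine ⟨(3 - L) / 4, (3 - L) / 30, by linarith, by linarith, by linarith, ?_⟩
  nlinarith [mul_pos (sub_pos.2 hL) (sub_pos.2 hL)]

theorem exists_normingOn {H₂ M : Submodule ℝ C(K₂, E₂)} (hBH : IsBoundary H₂ B) (hM : M ≤ H₂)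
    (T : H ≃L[ℝ] M) (hT : ‖(T : H →L[ℝ] M)‖ * ‖(T.symm : M →L[ℝ] H)‖ < 3) :
    ∃ (τ : H →ₗ[ℝ] C(K₂, E₂)) (L : ℝ), L < 3 ∧ NormingOn τ B L ∧ ∀ g, τ g ∈ H₂ := by
  set N := ‖(T : H →L[ℝ] M)‖ with hN
  set s := ‖(T.symm : M →L[ℝ] H)‖ with hs
  have hN0 : 0 ≤ N := ContinuousLinearMap.opNorm_nonneg _
  have hs0 : 0 ≤ s := ContinuousLinearMap.opNorm_nonneg _
  -- `c` is slightly larger than `‖T⁻¹‖` so that it is positive even when `H` is zero, while `c * N`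
  -- stays below 3.
  obtain ⟨c, hsc, hc, hcN⟩ : ∃ c, s ≤ c ∧ 0 < c ∧ c * N < 3 := by
    have h1 : 0 < (3 - N * s) / (2 * (N + 1)) := div_pos (by linarith) (by linarith)
    refine ⟨s + (3 - N * s) / (2 * (N + 1)), by linarith, by linarith, ?_⟩
    have h2 : (3 - N * s) / (2 * (N + 1)) * (2 * (N + 1)) = 3 - N * s :=
      div_mul_cancel₀ _ (by linarith)
    nlinarith
  refine ⟨c • (M.subtype ∘ₗ (T : H →L[ℝ] M).toLinearMap), c * N, hcN, ⟨by positivity, ?_, ?_⟩, ?_⟩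
  · intro g
    change ‖c • ((T g : M) : C(K₂, E₂))‖ ≤ _
    rw [norm_smul, Real.norm_of_nonneg hc.le, mul_assoc]
    exact mul_le_mul_of_nonneg_left ((T : H →L[ℝ] M).le_opNorm g) hc.le
  · intro g r hr hg
    have h1 : ‖((T g : M) : C(K₂, E₂))‖ ≤ r / c := by
      rw [hBH _ (hM (T g).2)]
      refine Real.iSup_le (fun y => ?_) (by positivity)
      have h2 := hg y y.2
      change ‖c • ((T g : M) : C(K₂, E₂)) y‖ ≤ r at h2
      rw [norm_smul, Real.norm_of_nonneg hc.le] at h2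
      rwa [le_div_iff₀' hc]
    have h2 := (T.symm : M →L[ℝ] H).le_opNorm (T g)
    have h3 : (T.symm : M →L[ℝ] H) (T g) = g := T.symm_apply_apply g
    rw [h3] at h2
    have h4 : ‖(g : C(K₁, E₁))‖ ≤ s * ‖((T g : M) : C(K₂, E₂))‖ := h2
    refine h4.trans ((mul_le_mul hsc h1 (norm_nonneg _) hc.le).trans ?_)
    rw [mul_div_cancel₀ _ hc.ne']
  · intro g
    exact H₂.smul_mem c (hM (T g).2)

end Normalization

/-! ### The finite-to-one map and the copy of `E₁ⁿ`. -/

section Embedding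

variable {K₁ K₂ : Type u} {E₁ E₂ : Type*} [TopologicalSpace K₁] [CompactSpace K₁] [T2Space K₁]
  [TopologicalSpace K₂] [CompactSpace K₂]
  [NormedAddCommGroup E₁] [NormedSpace ℝ E₁] [NormedAddCommGroup E₂] [NormedSpace ℝ E₂]
  {H : Submodule ℝ C(K₁, E₁)} {τ : H →ₗ[ℝ] C(K₂, E₂)} {B : Set K₂} {L : ℝ}

/-- There is a finite-to-one map from the derivatives of the set of weak peak points to those of
a closed boundary. -/
theorem exists_finite_fibers [CompleteSpace E₂] [Nontrivial E₁] (hE₂ : ¬ ContainsC0 E₂)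
    (hB : IsClosed B) (hτ : NormingOn τ B L) (hL : L < 3) (α : Ordinal.{u}) :
    ∃ f : iteratedDerivedSet (weakPeakPoints H) α → K₂,
      (∀ x, f x ∈ iteratedDerivedSet B α ∧ ∃ g, τ g (f x) ≠ 0) ∧ ∀ y, (f ⁻¹' {y}).Finite := by
  obtain ⟨δ, ε, hδ, hε, hε1, hδε⟩ := hτ.exists_constants hL
  obtain ⟨e, he⟩ : ∃ e : E₁, ‖e‖ = 1 := exists_norm_eq E₁ zero_le_one
  have key : ∀ x : iteratedDerivedSet (weakPeakPoints H) α, ∃ y ∈ iteratedDerivedSet B α,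
      (∃ g, τ g y ≠ 0) ∧ ∃ U ∈ 𝓝 (x : K₁), ∀ h : tensorSpace H, PeaksAt H h x U ε →
        δ ≤ ‖τ (tensorIn h e) y‖ := by
    rintro ⟨x, hx⟩
    obtain ⟨k, hk⟩ := exists_peaksAt (iteratedDerivedSet_subset _ _ hx) Filter.univ_mem hε hε1
    have hU : IsOpen {t | 1 - ε < (k : C(K₁, ℝ)) t} :=
      isOpen_lt continuous_const (k : C(K₁, ℝ)).continuous
    obtain ⟨y, hyB, hy, hyF⟩ := exists_mem_largeSet hE₂ hB hτ hε hε1 hδε hδ he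
      (f₀ := tensorIn k e) (fun t _ => by
        rw [tensorIn_apply, norm_smul, he, mul_one, Real.norm_of_nonneg (hk.nonneg t)]
        linarith [hk.le_one t]) hU (fun t ht => by
        have h1 := hk.le_one t
        have h2 : 1 - ε < (k : C(K₁, ℝ)) t := ht
        have h3 : (tensorIn k e : C(K₁, E₁)) t - e = ((k : C(K₁, ℝ)) t - 1) • e := by
          rw [tensorIn_apply, sub_smul, one_smul]
        rw [h3, norm_smul, he, mul_one, Real.norm_eq_abs, abs_le]
        constructor <;> linarith) α hx hk.lt_apply
    refine ⟨y, hyB, ⟨tensorIn k e, fun h0 => ?_⟩, _, hU.mem_nhds hk.lt_apply, hyF⟩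
    rw [h0, norm_zero] at hy
    linarith
  choose f hfB hf U hU hUf using key
  refine ⟨f, fun x => ⟨hfB x, hf x⟩, fun y => ?_⟩
  -- An infinite fibre over `y` accumulates in `K₁`. Peak functions at disjointly separated points
  -- of it would all have large images at `y`.
  by_contra hinf
  have hinf' : (Subtype.val '' (f ⁻¹' {y})).Infinite :=
    Set.Infinite.image Subtype.val_injective.injOn hinf
  obtain ⟨p, -, hp⟩ := hinf'.exists_accPt_of_subset_isCompact isCompact_univ (subset_univ _)
  obtain ⟨z, V, hz, hV⟩ := exists_seq_disjoint_nhds hp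
  choose x hxf hxz using fun n => (hz n).1
  have hpow : ∀ n : ℕ, (1 / 2 : ℝ) ^ n ≤ 1 := fun n => pow_le_one₀ (by norm_num) (by norm_num)
  have hpeak : ∀ n, ∃ h : tensorSpace H,
      PeaksAt H h (z n) (V n ∩ U (x n)) (ε * (1 / 2) ^ n) := by
    intro n
    have hUn := hU (x n)
    rw [hxz] at hUn
    have hW : z n ∈ weakPeakPoints H := by
      rw [← hxz]
      exact iteratedDerivedSet_subset _ _ (x n).2
    exact exists_peaksAt hW (Filter.inter_mem ((hz n).2.1.mem_nhds (hz n).2.2) hUn)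
      (by positivity) ((mul_le_of_le_one_right hε.le (hpow n)).trans_lt hε1)
  choose h hh using hpeak
  refine infinite_univ ((finite_setOf_le_apply hE₂ hτ hV (fun n => (hh n).mono inter_subset_left
    (mul_le_of_le_one_left (by positivity) hε1.le)) he hδ y).subset fun n _ => ?_)
  have h1 := hUf (x n) (h n) (by
    rw [hxz]
    exact (hh n).mono inter_subset_right (mul_le_of_le_one_right hε.le (hpow n)))
  have h2 : f (x n) = y := hxf n
  rwa [h2] at h1

/-- Smallness of `h` is known only on the Choquet boundary; it passes to `z` by continuity, since
`z` lies in the closure of that boundary. -/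
theorem PeaksAt.apply_le_of_disjoint {h : C(K₁, ℝ)} {x z : K₁} {V W : Set K₁} {ε : ℝ}
    (hh : PeaksAt H h x V ε) (hz : z ∈ weakPeakPoints H) (hW : IsOpen W) (hzW : z ∈ W)
    (hVW : Disjoint V W) : h z ≤ ε := by
  have h1 : z ∈ closure (W ∩ choquetBoundary H) :=
    hW.inter_closure ⟨hzW, weakPeakPoints_subset_closure H hz⟩
  exact closure_minimal (fun t ht => (hh.lt_of_notMem t ht.2 fun htV =>
    disjoint_left.1 hVW htV ht.1).le) (isClosed_le h.continuous continuous_const) h1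

/-- The embedding sends `v` to the values of `τ (∑ hᵢ ⊗ vᵢ)` at the points `q j`. For the lower
bound, normalize `v` and apply `exists_mem_largeSet` at the point of a coordinate of norm one, with
that coordinate as `e` and the sum itself as `f₀`; the resulting `y` is one of the `q j`. -/
theorem containsCopy_of_finite [CompleteSpace E₂] (hE₂ : ¬ ContainsC0 E₂)
    (hB : IsClosed B) (hτ : NormingOn τ B L) (hL : L < 3) (α : Ordinal.{u}) {ι κ : Type*}
    [Fintype ι] [Fintype κ] {p : ι → K₁} (hp : Function.Injective p)
    (hpW : ∀ i, p i ∈ iteratedDerivedSet (weakPeakPoints H) α) {q : κ → K₂}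
    (hq : ∀ y ∈ iteratedDerivedSet B α, ∀ g, τ g y ≠ 0 → y ∈ range q) :
    ContainsCopy (κ → E₂) (ι → E₁) := by
  classical
  obtain ⟨δ, ε, hδ, hε, hε1, hδε⟩ := hτ.exists_constants hL
  obtain ⟨V₀, hV₀, hV₀disj⟩ := (finite_range p).t2_separation
  set V : ι → Set K₁ := fun i => V₀ (p i) with hVdef
  have hV : Pairwise (Function.onFun Disjoint V) := fun i j hij =>
    hV₀disj (mem_range_self i) (mem_range_self j) (hp.ne hij)
  have hW : ∀ i, p i ∈ weakPeakPoints H := fun i => iteratedDerivedSet_subset _ _ (hpW i)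
  -- The `+ 1` makes the total of the errors strictly less than `ε` and avoids division by zero.
  set ε' : ℝ := ε / (Fintype.card ι + 1) with hε'
  have hε'pos : 0 < ε' := by positivity
  have hsum : ∑ _i : ι, ε' < ε := by
    rw [Finset.sum_const, Finset.card_univ, nsmul_eq_mul, hε', ← mul_div_assoc,
      div_lt_iff₀ (by positivity)]
    linarith
  have hε'1 : ε' ≤ ε := div_le_self hε.le (by
    have : (0 : ℝ) ≤ Fintype.card ι := by positivity
    linarith)
  choose h hh using fun i => exists_peaksAt (hW i) ((hV₀ (p i)).2.mem_nhds (hV₀ (p i)).1) hε'pos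
    (hε'1.trans_lt hε1)
  let G : (ι → E₁) →ₗ[ℝ] H :=
    { toFun := fun v => ∑ i, tensorIn (h i) (v i)
      map_add' := fun v w => by
        rw [← Finset.sum_add_distrib]
        refine Finset.sum_congr rfl fun i _ => Subtype.ext (ContinuousMap.ext fun t => ?_)
        exact smul_add _ _ _
      map_smul' := fun c v => by
        rw [RingHom.id_apply, Finset.smul_sum]
        refine Finset.sum_congr rfl fun i _ => Subtype.ext (ContinuousMap.ext fun t => ?_)
        exact smul_comm _ _ _ }
  have hG : ∀ v t, (G v : C(K₁, E₁)) t = ∑ i, (h i : C(K₁, ℝ)) t • v i := by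
    intro v t
    simp [G, ContinuousMap.sum_apply, tensorIn_apply]
  have hGle : ∀ v r, 0 ≤ r → (∀ i, ‖v i‖ ≤ r) → ∀ t ∈ choquetBoundary H,
      ‖(G v : C(K₁, E₁)) t‖ ≤ (1 + ε) * r := by
    intro v r hr hv t ht
    rw [hG]
    calc ‖∑ i, (h i : C(K₁, ℝ)) t • v i‖ ≤ ∑ i, (h i : C(K₁, ℝ)) t * r := by
          refine norm_sum_le_of_le _ fun i _ => ?_
          rw [norm_smul, Real.norm_of_nonneg ((hh i).nonneg t)]
          exact mul_le_mul_of_nonneg_left (hv i) ((hh i).nonneg t)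
      _ ≤ (1 + ε) * r := by
          rw [← Finset.sum_mul]
          refine mul_le_mul_of_nonneg_right ?_ hr
          refine (sum_le_one_add_of_disjoint hV (f := fun i => (h i : C(K₁, ℝ)))
            (ε := fun _ => ε') (fun _ => hε'pos.le) (fun i => (hh i).le_one t)
            (fun i hi => ((hh i).lt_of_notMem t ht hi).le) Finset.univ).trans ?_
          linarith
  let S : (ι → E₁) →ₗ[ℝ] (κ → E₂) :=
    { toFun := fun v j => τ (G v) (q j)
      map_add' := fun v w => by
        ext j
        simp
      map_smul' := fun c v => by
        ext j
        simp }
  refine containsCopy_of_bounds S hδ (C := L * (1 + ε)) (fun v => ?_) (fun v => ?_)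
  · rcases eq_or_ne v 0 with rfl | hv
    · simp
    have hr : 0 < ‖v‖ := norm_pos_iff.2 hv
    obtain ⟨i₀, hi₀⟩ : ∃ i, ‖v i‖ = ‖v‖ := by
      by_contra! hne
      have := (pi_norm_lt_iff hr).2 fun i => lt_of_le_of_ne (norm_le_pi_norm v i) (hne i)
      exact this.false
    set w : ι → E₁ := ‖v‖⁻¹ • v with hw
    have hw1 : ∀ i, ‖w i‖ ≤ 1 := by
      intro i
      rw [hw, Pi.smul_apply, norm_smul, norm_inv, norm_norm, inv_mul_le_iff₀ hr, mul_one]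
      exact norm_le_pi_norm v i
    have hwe : ‖w i₀‖ = 1 := by
      rw [hw, Pi.smul_apply, norm_smul, norm_inv, norm_norm, hi₀, inv_mul_cancel₀ hr.ne']
    have hpU : ‖(G w : C(K₁, E₁)) (p i₀) - w i₀‖ < ε := by
      have h1 : (G w : C(K₁, E₁)) (p i₀) - w i₀
          = ∑ i, ((h i : C(K₁, ℝ)) (p i₀) - if i = i₀ then 1 else 0) • w i := by
        simp [hG, sub_smul, Finset.sum_sub_distrib]
      rw [h1]
      refine (norm_sum_le_of_le (f := fun i =>
        ((h i : C(K₁, ℝ)) (p i₀) - if i = i₀ then 1 else 0) • w i) (n := fun _ => ε')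
        Finset.univ fun i _ => ?_).trans_lt hsum
      rw [norm_smul]
      refine (mul_le_of_le_one_right (norm_nonneg _) (hw1 i)).trans ?_
      have h0 := (hh i).nonneg (p i₀)
      rw [Real.norm_eq_abs, abs_le]
      split_ifs with hi
      · subst hi
        have h2 := (hh i).lt_apply
        have h3 := (hh i).le_one (p i)
        constructor <;> linarith
      · have h2 := (hh i).apply_le_of_disjoint (hW i₀) (hV₀ (p i₀)).2 (hV₀ (p i₀)).1 (hV hi)
        constructor <;> linarith
    obtain ⟨y, hyB, hy, -⟩ := exists_mem_largeSet hE₂ hB hτ hε hε1 hδε hδ hwe (f₀ := G w)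
      (by simpa using hGle w 1 zero_le_one hw1)
      (isOpen_lt ((G w : C(K₁, E₁)).continuous.sub continuous_const).norm continuous_const)
      (fun t ht => le_of_lt ht) α (hpW i₀) hpU
    obtain ⟨j, rfl⟩ := hq y hyB (G w) fun h0 => by
      rw [h0, norm_zero] at hy
      linarith
    have h1 : S w j = τ (G w) (q j) := rfl
    have h2 : S v = ‖v‖ • S w := by
      rw [← map_smul, hw, smul_inv_smul₀ hr.ne']
    rw [h2, norm_smul, norm_norm, mul_comm]
    refine mul_le_mul_of_nonneg_left ?_ hr.le
    rw [← h1] at hy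
    exact hy.trans (norm_le_pi_norm _ j)
  · rw [pi_norm_le_iff_of_nonneg (mul_nonneg (mul_nonneg hτ.nonneg (by linarith))
      (norm_nonneg v))]
    intro j
    rw [mul_assoc]
    exact hτ.norm_apply_le (G v) (mul_nonneg (by linarith) (norm_nonneg v))
      (hGle v _ (norm_nonneg v) fun i => norm_le_pi_norm v i) (q j)

end Embedding

theorem le_of_containsCopy_pi {E₁ E₂ : Type*} [NormedAddCommGroup E₁] [NormedSpace ℝ E₁]
    [Nontrivial E₁] [NormedAddCommGroup E₂] [NormedSpace ℝ E₂] [FiniteDimensional ℝ E₁]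
    (e : E₁ ≃L[ℝ] E₂) {n m : ℕ} (h : ContainsCopy (Fin m → E₂) (Fin n → E₁)) : n ≤ m := by
  obtain ⟨M, ⟨S⟩⟩ := h
  have : FiniteDimensional ℝ E₂ := e.toLinearEquiv.finiteDimensional
  have h1 := S.toLinearEquiv.finrank_eq.trans_le M.finrank_le
  have h2 : Module.finrank ℝ E₁ = Module.finrank ℝ E₂ := e.toLinearEquiv.finrank_eq
  rw [Module.finrank_pi_fintype, Module.finrank_pi_fintype] at h1
  simp only [Finset.sum_const, Finset.card_univ, Fintype.card_fin, smul_eq_mul, ← h2] at h1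
  exact Nat.le_of_mul_le_mul_right h1 Module.finrank_pos

end VectorFunctionSpace

end

/-! ### Derivation of the four statements. -/

theorem theorem1p1 {K₁ K₂ : Type u} {E₁ : Type v} {E₂ : Type w}
    [TopologicalSpace K₁] [CompactSpace K₁] [T2Space K₁]
    [TopologicalSpace K₂] [CompactSpace K₂] [T2Space K₂]
    [NormedAddCommGroup E₁] [NormedSpace ℝ E₁] [CompleteSpace E₁] [Nontrivial E₁]
    [NormedAddCommGroup E₂] [NormedSpace ℝ E₂] [CompleteSpace E₂] [Nontrivial E₂]
    (H₁ : Submodule ℝ C(K₁, E₁)) (hH₁ : IsClosed (H₁ : Set C(K₁, E₁)))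
    (H₂ : Submodule ℝ C(K₂, E₂)) (hH₂ : IsClosed (H₂ : Set C(K₂, E₂)))
    (hE₂ : ¬ VectorFunctionSpace.ContainsC0 E₂)
    (B : Set K₂) (hBclosed : IsClosed B) (hB : VectorFunctionSpace.IsBoundary H₂ B)
    (M : Submodule ℝ C(K₂, E₂)) (hM : M ≤ H₂) (T : H₁ ≃L[ℝ] M)
    (hT : ‖(T : H₁ →L[ℝ] M)‖ * ‖(T.symm : M →L[ℝ] H₁)‖ < 3)
    (α : Ordinal.{u}) :
    ((iteratedDerivedSet (VectorFunctionSpace.weakPeakPoints H₁) α).Nonempty →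
      (iteratedDerivedSet B α ∩ VectorFunctionSpace.nonvanishingSet H₂).Nonempty) ∧
    ((iteratedDerivedSet B α ∩ VectorFunctionSpace.nonvanishingSet H₂).Finite →
      (iteratedDerivedSet (VectorFunctionSpace.weakPeakPoints H₁) α).Finite) ∧
    ((iteratedDerivedSet B α ∩ VectorFunctionSpace.nonvanishingSet H₂).Finite →
      ∀ n m : ℕ, n = (iteratedDerivedSet (VectorFunctionSpace.weakPeakPoints H₁) α).ncard →
        m = (iteratedDerivedSet B α ∩ VectorFunctionSpace.nonvanishingSet H₂).ncard →
        VectorFunctionSpace.ContainsCopy (Fin m → E₂) (Fin n → E₁) ∧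
        (FiniteDimensional ℝ E₁ → Nonempty (E₁ ≃L[ℝ] E₂) → n ≤ m)) ∧
    ((∀ e : E₁, ContinuousMap.const K₁ e ∈ H₁) →
      (iteratedDerivedSet B α ∩ VectorFunctionSpace.nonvanishingSet H₂).Infinite →
      #(iteratedDerivedSet (VectorFunctionSpace.weakPeakPoints H₁) α) ≤
        #↥(iteratedDerivedSet B α ∩ VectorFunctionSpace.nonvanishingSet H₂)) := by
  open VectorFunctionSpace in
  obtain ⟨τ, L, hL, hτ, hτH⟩ := exists_normingOn hB hM T hT
  obtain ⟨f, hf, hfib⟩ := exists_finite_fibers hE₂ hBclosed hτ hL α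
  have hfmem : ∀ x, f x ∈ iteratedDerivedSet B α ∩ nonvanishingSet H₂ := fun x =>
    ⟨(hf x).1, let ⟨g, hg⟩ := (hf x).2; ⟨τ g, hτH g, hg⟩⟩
  set F : iteratedDerivedSet (weakPeakPoints H₁) α →
    ↥(iteratedDerivedSet B α ∩ nonvanishingSet H₂) := fun x => ⟨f x, hfmem x⟩ with hF
  have hFfib : ∀ y, (F ⁻¹' {y}).Finite := fun y => (hfib y).subset fun x hx =>
    congrArg Subtype.val hx
  have hfinite : (iteratedDerivedSet B α ∩ nonvanishingSet H₂).Finite →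
      (iteratedDerivedSet (weakPeakPoints H₁) α).Finite := by
    intro h
    have := h.to_subtype
    have h1 : (univ : Set (iteratedDerivedSet (weakPeakPoints H₁) α)).Finite := by
      have h2 : (univ : Set (iteratedDerivedSet (weakPeakPoints H₁) α)) = ⋃ y, F ⁻¹' {y} :=
        (iUnion_eq_univ_iff.2 fun x => ⟨F x, rfl⟩).symm
      rw [h2]
      exact finite_iUnion hFfib
    exact Set.finite_coe_iff.1 (Set.finite_univ_iff.1 h1)
  refine ⟨fun ⟨x, hx⟩ => ⟨f ⟨x, hx⟩, hfmem _⟩, hfinite, ?_, ?_⟩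
  · rintro h n m rfl rfl
    have h1 := hfinite h
    have := h.to_subtype
    have := h1.to_subtype
    have hcopy : ContainsCopy
        (Fin (iteratedDerivedSet B α ∩ nonvanishingSet H₂).ncard → E₂)
        (Fin (iteratedDerivedSet (weakPeakPoints H₁) α).ncard → E₁) := by
      rw [← Nat.card_coe_set_eq, ← Nat.card_coe_set_eq]
      refine containsCopy_of_finite hE₂ hBclosed hτ hL α
        (p := fun i => ((Finite.equivFin (iteratedDerivedSet (weakPeakPoints H₁) α)).symm i : K₁))
        (Subtype.val_injective.comp (Equiv.injective _)) (fun i => Subtype.prop _)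
        (q := fun j => ((Finite.equivFin
          ↥(iteratedDerivedSet B α ∩ nonvanishingSet H₂)).symm j : K₂)) ?_
      intro y hy g hg
      exact ⟨Finite.equivFin _ ⟨y, hy, τ g, hτH g, hg⟩,
        congrArg Subtype.val (Equiv.symm_apply_apply _ _)⟩
    exact ⟨hcopy, fun _ ⟨e⟩ => le_of_containsCopy_pi e hcopy⟩
  · intro _ h
    have := h.to_subtype
    -- Countable fibres cost a factor `ℵ₀`, which an infinite cardinal absorbs.
    refine (Cardinal.mk_le_mk_mul_of_mk_preimage_le (c := ℵ₀) F fun y => ?_).trans ?_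
    · exact (Set.Finite.lt_aleph0 (hFfib y)).le
    · rw [Cardinal.mul_aleph0_eq (Cardinal.aleph0_le_mk _)]
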